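/- Let $\mathbb{C}^3$ carry the pseudo-Hermitian form $\langle z,w\rangle=i(\bar z^1w^3-\bar z^3w^1)+\bar z^2w^2$, and identify the unit sphere $S^3\subset\mathbb{C}^2$ with the real hyperquadric $\langle z,z\rangle=0$ of $\mathbb{CP}^2$ by $(z^1,z^2)\mapsto[\tfrac{1+z^1}{2},\,i\tfrac{z^2}{\sqrt2},\,i\tfrac{1-z^1}{2}]$; its contact distribution is the kernel of $\langle z,dz\rangle$. Let $J\subset\mathbb{R}$ be a non-empty open interval. A Legendrian curve $\gamma:J\to S^3$ is a smooth immersion tangent to the contact distribution. It has a smooth lift $\Gamma:J\to\mathbb{C}^3\setminus\{0\}$ with $\gamma=[\Gamma]$ and $\det(\Gamma,\Gamma',\Gamma'')=i$, unique up to a cubic root of unity. Put $$a=\mathrm{Im}\langle\Gamma''',\Gamma''\rangle,\qquad b=\tfrac12\langle\Gamma'',\Gamma''\rangle .$$ The cubic Fubini form is $a\,dt^3$ and the strain density is $\sqrt[3]{|a|}$. The curve is a cycle if $a$ is identically zero, and generic if $a$ vanishes nowhere. The stress tensor is $\mathfrak t=\mathtt t\,dt^{20}$ with $$\begin{aligned}\mathtt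 t={}&\tfrac{4400}{81}aa'^3a''+a^2\left(-\tfrac{400}{27}ba'^3-\tfrac{200}{9}a'a''^2-\tfrac{400}{27}a'^2a'''\right)\\&+a^3\left(\tfrac{25}{3}a'^2b'+\tfrac{50}{3}ba'a''+\tfrac{50}{9}a''a'''+\tfrac{25}{9}a'a^{(4)}\right)\\&+a^4\left(-\tfrac{16}{3}b^2a'-5b'a''-3a'b''-\tfrac{10}{3}ba'''-\tfrac13a^{(5)}\right)+a^5(8bb'+b''')-\tfrac{6160}{243}a'^5 .\end{aligned}$$ An admissible variation of $\gamma$ is a smooth map $g:J\times(-\varepsilon,\varepsilon)\to S^3$, $\varepsilon>0$, such that $g(\cdot,0)=\gamma$, every $g_\tau=g(\cdot,\tau)$ is a Legendrian curve, the support $K_g\subset J$ of the variational vector field $t\mapsto\partial_\tau g(t,0)$ is compact, and the function $\mathfrak S_g(\tau)=\int_{K_g}\sqrt[3]{|a_\tau|}\,dt$ is differentiable at $\tau=0$, where $a_\tau$ is the function $a$ of the curve $g_\tau$. The curve $\gamma$ is critical for the total strain functional if $\mathfrak S_g'(0)=0$ for every admissible variation $g$. **Theorem A.** A Legendrian curve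 $\gamma:J\to S^3$ is critical for the total strain functional if and only if its stress tensor vanishes identically. Moreover, a critical curve is either a cycle or generic. -/

import Mathlib

open scoped ContDiff

noncomputable section

namespace CRStrain

/-- The ambient complex plane `ℂ²` of the 3-sphere, with its Hermitian norm. -/
abbrev C2 : Type := EuclideanSpace ℂ (Fin 2)

/-- The vector space `ℂ³` (homogeneous coordinates on the complex projective plane). -/
abbrev C3 : Type := Fin 3 → ℂ

/-- The pseudo-Hermitian form of signature (2,1) on `ℂ³`:
`⟨z, w⟩ = i (z̄¹ w³ - z̄³ w¹) + z̄² w²`. -/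
def herm (z w : C3) : ℂ :=
  Complex.I * (starRingEnd ℂ (z 0) * w 2 - starRingEnd ℂ (z 2) * w 0)
    + starRingEnd ℂ (z 1) * w 1

/-- Homogeneous coordinates of the image of a point of the 3-sphere under the embedding
`z ↦ [(1 + z¹)/2, i z²/√2, i (1 - z¹)/2]` onto the real hyperquadric `⟨z, z⟩ = 0` of the
complex projective plane. -/
def homog (z : C2) : C3 :=
  ![(1 + z 0) / 2, Complex.I * z 1 / (Real.sqrt 2 : ℂ), Complex.I * (1 - z 0) / 2]

/-- `γ`, restricted to the open interval `J`, is a Legendrian curve of the CR 3-sphere: a smooth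
immersion into the unit sphere of `ℂ²` tangent to the contact distribution, which is the kernel
on the sphere of the 1-form `⟨z, dz⟩` in the homogeneous coordinates `homog`. -/
structure IsLegendrian (J : Set ℝ) (γ : ℝ → C2) : Prop where
  smooth : ContDiffOn ℝ ∞ γ J
  mem_sphere : ∀ t ∈ J, ‖γ t‖ = 1
  immersion : ∀ t ∈ J, deriv γ t ≠ 0
  contact : ∀ t ∈ J, herm (homog (γ t)) (deriv (fun u => homog (γ u)) t) = 0

/-- `Γ` is a normalized lift of `γ` on `J`: a smooth map into `ℂ³ ∖ {0}` which projects to `γ`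
in the complex projective plane and satisfies `det (Γ, Γ', Γ'') = i`. -/
structure IsNormalizedLift (J : Set ℝ) (γ : ℝ → C2) (Γ : ℝ → C3) : Prop where
  smooth : ContDiffOn ℝ ∞ Γ J
  lift : ∀ t ∈ J, ∃ c : ℂ, c ≠ 0 ∧ Γ t = c • homog (γ t)
  normalized : ∀ t ∈ J,
    (Matrix.of ![Γ t, iteratedDeriv 1 Γ t, iteratedDeriv 2 Γ t]).det = Complex.I

open Classical in
/-- A normalized lift of `γ` on `J`. A Legendrian curve has one, unique up to multiplication by a
cubic root of unity, which does not affect the densities below. (If there is none, the value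
is `0`.) -/
def normalizedLift (J : Set ℝ) (γ : ℝ → C2) : ℝ → C3 :=
  if h : ∃ Γ : ℝ → C3, IsNormalizedLift J γ Γ then h.choose else 0

/-- The density `a = Im ⟨Γ''', Γ''⟩` of the cubic Fubini form `a dt³`. -/
def cubicDensity (J : Set ℝ) (γ : ℝ → C2) (t : ℝ) : ℝ :=
  (herm (iteratedDeriv 3 (normalizedLift J γ) t) (iteratedDeriv 2 (normalizedLift J γ) t)).im

/-- The density `b = ⟨Γ'', Γ''⟩ / 2` of the quadratic Fubini form `b dt²`. -/
def quadraticDensity (J : Set ℝ) (γ : ℝ → C2) (t : ℝ) : ℝ :=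
  (herm (iteratedDeriv 2 (normalizedLift J γ) t)
    (iteratedDeriv 2 (normalizedLift J γ) t)).re / 2

/-- The strain density `∛|a|`. -/
def strainDensity (J : Set ℝ) (γ : ℝ → C2) (t : ℝ) : ℝ :=
  |cubicDensity J γ t| ^ (1 / 3 : ℝ)

/-- A cycle: the cubic form vanishes identically. -/
def IsCycle (J : Set ℝ) (γ : ℝ → C2) : Prop :=
  ∀ t ∈ J, cubicDensity J γ t = 0

/-- A generic curve: the cubic form vanishes nowhere. -/
def IsGeneric (J : Set ℝ) (γ : ℝ → C2) : Prop :=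
  ∀ t ∈ J, cubicDensity J γ t ≠ 0

/-- The differential polynomial in two functions `a`, `b` that gives the stress density. -/
def stressPolynomial (a b : ℝ → ℝ) (t : ℝ) : ℝ :=
  let a0 := a t
  let a1 := iteratedDeriv 1 a t
  let a2 := iteratedDeriv 2 a t
  let a3 := iteratedDeriv 3 a t
  let a4 := iteratedDeriv 4 a t
  let a5 := iteratedDeriv 5 a t
  let b0 := b t
  let b1 := iteratedDeriv 1 b t
  let b2 := iteratedDeriv 2 b t
  let b3 := iteratedDeriv 3 b t
  4400 / 81 * a0 * a1 ^ 3 * a2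
    + a0 ^ 2 * (-(400 / 27) * b0 * a1 ^ 3 - 200 / 9 * a1 * a2 ^ 2 - 400 / 27 * a1 ^ 2 * a3)
    + a0 ^ 3 * (25 / 3 * a1 ^ 2 * b1 + 50 / 3 * b0 * a1 * a2 + 50 / 9 * a2 * a3
        + 25 / 9 * a1 * a4)
    + a0 ^ 4 * (-(16 / 3) * b0 ^ 2 * a1 - 5 * b1 * a2 - 3 * a1 * b2 - 10 / 3 * b0 * a3
        - 1 / 3 * a5)
    + a0 ^ 5 * (8 * b0 * b1 + b3)
    - 6160 / 243 * a1 ^ 5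

/-- The density of the stress tensor, a differential form of degree 20 along the curve. -/
def stressDensity (J : Set ℝ) (γ : ℝ → C2) (t : ℝ) : ℝ :=
  stressPolynomial (cubicDensity J γ) (quadraticDensity J γ) t

/-- The stress tensor of `γ` is identically zero. -/
def StressVanishes (J : Set ℝ) (γ : ℝ → C2) : Prop :=
  ∀ t ∈ J, stressDensity J γ t = 0

/-- The variational vector field `∂g/∂τ (t, 0)` of a one-parameter family of curves. -/
def variationField (g : ℝ → ℝ → C2) (t : ℝ) : C2 :=
  deriv (fun τ => g t τ) 0

/-- The support of the variational vector field: the closure in `J` of the set of points of `J`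
at which it does not vanish. -/
def variationSupport (J : Set ℝ) (g : ℝ → ℝ → C2) : Set ℝ :=
  J ∩ closure {t | t ∈ J ∧ variationField g t ≠ 0}

/-- The total strain of the curve `g_τ = g(·, τ)` over the support of the variational field. -/
def strainFunctional (J : Set ℝ) (g : ℝ → ℝ → C2) (τ : ℝ) : ℝ :=
  ∫ t in variationSupport J g, strainDensity J (fun u => g u τ) t

/-- Admissible variations of `γ` on the rectangle `J × (-ε, ε)`. -/
structure IsAdmissibleVariation (J : Set ℝ) (γ : ℝ → C2) (ε : ℝ) (g : ℝ → ℝ → C2) :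
    Prop where
  smooth : ContDiffOn ℝ ∞ (fun x : ℝ × ℝ => g x.1 x.2) (J ×ˢ Set.Ioo (-ε) ε)
  initial : ∀ t ∈ J, g t 0 = γ t
  legendrian : ∀ τ ∈ Set.Ioo (-ε) ε, IsLegendrian J (fun t => g t τ)
  compact_support : IsCompact (variationSupport J g)
  differentiable : DifferentiableAt ℝ (strainFunctional J g) 0

/-- `γ` is critical for the total strain functional. -/
def IsCritical (J : Set ℝ) (γ : ℝ → C2) : Prop :=
  ∀ ε : ℝ, 0 < ε → ∀ g : ℝ → ℝ → C2, IsAdmissibleVariation J γ ε g →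
    deriv (strainFunctional J g) 0 = 0

end CRStrain

end

/-!
Write `Γ` for a normalized lift. The products of `Γ, Γ', Γ''` are constant except
`⟨Γ'', Γ''⟩ = 2b`, and the Frenet equation is `Γ''' = (-b' + i a) Γ - 2b Γ'`
(`IsNormalizedLift.third_deriv`). Let
`D φ = φ⁽⁵⁾ + 10 b φ''' + 15 b' φ'' + (9 b'' + 16 b²) φ' + (2 b''' + 16 b b') φ`,
a skew-adjoint operator with smooth coefficients on the whole interval, and let `u = a |a|^(-5/3)`
where `a ≠ 0`. The theorem rests on three facts.

* The stress polynomial `𝚝` is `D u` in disguise: `a⁵ D u = 2 u 𝚝` (`fifthOrder_multiplier`).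

* A variation with contact Hamiltonian `h` and tangential part `f` changes `a` to first order by
  `f a' + 3 f' a + D h / 6` (`cubic_linearization`). As `u` is three times the derivative of
  `|a|^(1/3)` in `a`, and `u (f a' + 3 f' a) / 3` is the derivative of `f u a`, integration by parts
  gives `-(1/18) ∫ h D u` as the derivative of the total strain, if `a` has no zeros near the support
  (`IsJointLift.hasDerivAt_strainFunctional`). Near a point off one pole of the sphere any `h` with
  compact support occurs, up to a positive factor (`exists_variation`): in Heisenberg coordinates the
  Legendrian condition is solved for the height explicitly. Hence a critical curve has `D u = 0`
  wherever `a ≠ 0`.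

* A solution of `D u = 0` stays bounded on a bounded interval by Grönwall's inequality, whereas
  `|u|³ a² = 1`. So if `D u = 0` wherever `a ≠ 0`, then `a` cannot approach zero from where it is
  nonzero: it vanishes identically or nowhere (`eq_zero_or_ne_zero_of_fifthOrder`).

So the stress vanishes iff `D u = 0` wherever `a ≠ 0`, and then the curve is a cycle or generic. A
generic curve of this kind is critical by the first variation formula, and a cycle because the
total strain is nonnegative and vanishes on it.
-/

open scoped Matrix

namespace CRStrain

/-! ### Iterated and partial derivatives -/

section Calculus

variable {E : Type*} [NormedAddCommGroup E] [NormedSpace ℝ E]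

theorem contDiffOn_iteratedDeriv {J : Set ℝ} (hJ : IsOpen J) {F : ℝ → E}
    (hF : ContDiffOn ℝ ∞ F J) (n : ℕ) : ContDiffOn ℝ ∞ (iteratedDeriv n F) J := by
  induction n with
  | zero => simpa using hF
  | succ n ih =>
    rw [iteratedDeriv_succ]
    exact ((contDiffOn_infty_iff_deriv_of_isOpen hJ).1 ih).2

theorem hasDerivAt_iteratedDeriv {J : Set ℝ} (hJ : IsOpen J) {F : ℝ → E}
    (hF : ContDiffOn ℝ ∞ F J) (n : ℕ) {t : ℝ} (ht : t ∈ J) :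
    HasDerivAt (iteratedDeriv n F) (iteratedDeriv (n + 1) F t) t := by
  rw [iteratedDeriv_succ]
  exact (((contDiffOn_iteratedDeriv hJ hF n).differentiableOn (by simp)).differentiableAt
    (hJ.mem_nhds ht)).hasDerivAt

theorem hasDerivAt_of_contDiffOn {J : Set ℝ} (hJ : IsOpen J) {F : ℝ → E}
    (hF : ContDiffOn ℝ ∞ F J) {t : ℝ} (ht : t ∈ J) :
    HasDerivAt F (iteratedDeriv 1 F t) t := by
  simpa using hasDerivAt_iteratedDeriv hJ hF 0 ht

theorem iteratedDeriv_eqOn {J : Set ℝ} (hJ : IsOpen J) {F G : ℝ → E} (h : Set.EqOn F G J)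
    (n : ℕ) : Set.EqOn (iteratedDeriv n F) (iteratedDeriv n G) J := fun _ ht =>
  Filter.EventuallyEq.iteratedDeriv_eq n (h.eventuallyEq_of_mem (hJ.mem_nhds ht))

/-- If `G` is pointwise the derivative of the `n`-th derivative of `F`, it is the next one. -/
theorem iteratedDeriv_succ_eqOn {J : Set ℝ} (hJ : IsOpen J) {F G G' : ℝ → E} {n : ℕ}
    (h : Set.EqOn (iteratedDeriv n F) G J) (hG : ∀ t ∈ J, HasDerivAt G (G' t) t) :
    Set.EqOn (iteratedDeriv (n + 1) F) G' J := fun t ht => by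
  rw [iteratedDeriv_succ, (h.eventuallyEq_of_mem (hJ.mem_nhds ht)).deriv_eq, (hG t ht).deriv]

theorem contDiffOn_deriv {J : Set ℝ} (hJ : IsOpen J) {F : ℝ → E}
    (hF : ContDiffOn ℝ ∞ F J) : ContDiffOn ℝ ∞ (deriv F) J :=
  ((contDiffOn_infty_iff_deriv_of_isOpen hJ).1 hF).2

/-- The partial derivative in the first variable (the parameter of the curves). -/
noncomputable def partialT (F : ℝ × ℝ → E) (x : ℝ × ℝ) : E := fderiv ℝ F x (1, 0)

/-- The partial derivative in the second variable (the parameter of the family). -/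
noncomputable def partialS (F : ℝ × ℝ → E) (x : ℝ × ℝ) : E := fderiv ℝ F x (0, 1)

variable {U : Set (ℝ × ℝ)} {F : ℝ × ℝ → E}

theorem contDiffOn_partialT (hU : IsOpen U) (hF : ContDiffOn ℝ ∞ F U) :
    ContDiffOn ℝ ∞ (partialT F) U :=
  (hF.fderiv_of_isOpen hU (by simp)).clm_apply contDiffOn_const

theorem contDiffOn_partialS (hU : IsOpen U) (hF : ContDiffOn ℝ ∞ F U) :
    ContDiffOn ℝ ∞ (partialS F) U :=
  (hF.fderiv_of_isOpen hU (by simp)).clm_apply contDiffOn_const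

theorem hasFDerivAt_of_contDiffOn (hU : IsOpen U) (hF : ContDiffOn ℝ ∞ F U) {x : ℝ × ℝ}
    (hx : x ∈ U) : HasFDerivAt F (fderiv ℝ F x) x :=
  ((hF.differentiableOn (by simp)).differentiableAt (hU.mem_nhds hx)).hasFDerivAt

theorem hasDerivAt_partialT (hU : IsOpen U) (hF : ContDiffOn ℝ ∞ F U) {t s : ℝ}
    (hx : (t, s) ∈ U) : HasDerivAt (fun u => F (u, s)) (partialT F (t, s)) t :=
  (hasFDerivAt_of_contDiffOn hU hF hx).comp_hasDerivAt t
    ((hasDerivAt_id t).prodMk (hasDerivAt_const t s))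

theorem hasDerivAt_partialS (hU : IsOpen U) (hF : ContDiffOn ℝ ∞ F U) {t s : ℝ}
    (hx : (t, s) ∈ U) : HasDerivAt (fun v => F (t, v)) (partialS F (t, s)) s :=
  (hasFDerivAt_of_contDiffOn hU hF hx).comp_hasDerivAt s
    ((hasDerivAt_const s t).prodMk (hasDerivAt_id s))

theorem partialS_partialT (hU : IsOpen U) (hF : ContDiffOn ℝ ∞ F U) {x : ℝ × ℝ}
    (hx : x ∈ U) : partialS (partialT F) x = partialT (partialS F) x := by
  have hd : DifferentiableAt ℝ (fderiv ℝ F) x :=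
    ((hF.fderiv_of_isOpen (m := ∞) hU (by simp)).differentiableOn (by simp)).differentiableAt
      (hU.mem_nhds hx)
  have key : ∀ v w : ℝ × ℝ, fderiv ℝ (fun y => fderiv ℝ F y v) x w = fderiv ℝ (fderiv ℝ F) x w v :=
    fun v w => by
      rw [fderiv_clm_apply hd (differentiableAt_const v)]
      simp
  have hs : IsSymmSndFDerivAt ℝ F x :=
    (hF.contDiffAt (hU.mem_nhds hx)).isSymmSndFDerivAt
      (by simpa using WithTop.coe_le_coe.2 (le_top : (2 : ℕ∞) ≤ ⊤))
  change fderiv ℝ (fun y => fderiv ℝ F y (1, 0)) x (0, 1)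
    = fderiv ℝ (fun y => fderiv ℝ F y (0, 1)) x (1, 0)
  rw [key, key]
  exact hs _ _

theorem partialT_congr (hU : IsOpen U) {G : ℝ × ℝ → E} (h : Set.EqOn F G U) :
    Set.EqOn (partialT F) (partialT G) U := fun x hx => by
  simp only [partialT]
  rw [(h.eventuallyEq_of_mem (hU.mem_nhds hx)).fderiv_eq]

theorem contDiffOn_iterate_partialT (hU : IsOpen U) (hF : ContDiffOn ℝ ∞ F U) (k : ℕ) :
    ContDiffOn ℝ ∞ (partialT^[k] F) U := by
  induction k with
  | zero => exact hF
  | succ k ih =>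
    rw [Function.iterate_succ_apply']
    exact contDiffOn_partialT hU ih

theorem partialS_iterate_partialT (hU : IsOpen U) (hF : ContDiffOn ℝ ∞ F U) (k : ℕ) :
    Set.EqOn (partialS (partialT^[k] F)) (partialT^[k] (partialS F)) U := by
  induction k with
  | zero => exact fun x _ => rfl
  | succ k ih =>
    intro x hx
    rw [Function.iterate_succ_apply', Function.iterate_succ_apply',
      partialS_partialT hU (contDiffOn_iterate_partialT hU hF k) hx]
    exact partialT_congr hU ih hx

/-- The open slice of `U` at the parameter `s` of the family. -/
def slice (U : Set (ℝ × ℝ)) (s : ℝ) : Set ℝ := {t | (t, s) ∈ U}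

theorem isOpen_slice (hU : IsOpen U) (s : ℝ) : IsOpen (slice U s) :=
  hU.preimage (by fun_prop)

theorem contDiffOn_slice (hF : ContDiffOn ℝ ∞ F U) (s : ℝ) :
    ContDiffOn ℝ ∞ (fun t => F (t, s)) (slice U s) :=
  hF.comp (t := U) (s := slice U s) (f := fun t : ℝ => (t, s))
    (contDiff_id.prodMk contDiff_const).contDiffOn (fun _ ht => ht)

theorem iteratedDeriv_slice (hU : IsOpen U) (hF : ContDiffOn ℝ ∞ F U) (k : ℕ) (s : ℝ) :
    Set.EqOn (iteratedDeriv k (fun t => F (t, s))) (fun t => (partialT^[k] F) (t, s))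
      (slice U s) := by
  induction k with
  | zero => exact fun t _ => by simp
  | succ k ih =>
    refine iteratedDeriv_succ_eqOn (isOpen_slice hU s) ih fun t ht => ?_
    rw [Function.iterate_succ_apply']
    exact hasDerivAt_partialT hU (contDiffOn_iterate_partialT hU hF k) ht

end Calculus

/-! ### The pseudo-Hermitian form and determinants -/

theorem herm_add_left (x y z : C3) : herm (x + y) z = herm x z + herm y z := by
  simp [herm]; ring

theorem herm_add_right (x y z : C3) : herm x (y + z) = herm x y + herm x z := by
  simp [herm]; ring

theorem herm_smul_left (c : ℂ) (x y : C3) :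
    herm (c • x) y = starRingEnd ℂ c * herm x y := by
  simp [herm]; ring

theorem herm_smul_right (c : ℂ) (x y : C3) : herm x (c • y) = c * herm x y := by
  simp [herm]; ring

theorem conj_herm (x y : C3) : starRingEnd ℂ (herm x y) = herm y x := by
  simp [herm]; ring

/-- The pseudo-Hermitian form as a real bilinear map. -/
noncomputable def hermB : C3 →L[ℝ] C3 →L[ℝ] ℂ :=
  (LinearMap.mk₂ ℝ herm herm_add_left
    (fun c x y => by simp [herm]; ring) herm_add_right
    (fun c x y => by simp [herm]; ring)).toContinuousBilinearMap

theorem hermB_apply (x y : C3) : hermB x y = herm x y := rfl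

theorem hasDerivAt_herm {u v : ℝ → C3} {u' v' : C3} {t : ℝ} (hu : HasDerivAt u u' t)
    (hv : HasDerivAt v v' t) :
    HasDerivAt (fun s => herm (u s) (v s)) (herm u' (v t) + herm (u t) v') t := by
  have h := hermB.hasDerivAt_of_bilinear (fun _ => hu) (fun _ => hv)
  simp only [hermB_apply] at h
  rwa [add_comm]

theorem contDiffOn_herm {E : Type*} [NormedAddCommGroup E] [NormedSpace ℝ E] {u v : E → C3}
    {U : Set E} (hu : ContDiffOn ℝ ∞ u U) (hv : ContDiffOn ℝ ∞ v U) :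
    ContDiffOn ℝ ∞ (fun x => herm (u x) (v x)) U :=
  ((contDiffOn_const (c := hermB)).clm_apply hu).clm_apply hv

/-- The determinant of three vectors of `ℂ³`. -/
noncomputable def det3 (x y z : C3) : ℂ := (Matrix.of ![x, y, z]).det

theorem det3_eq (x y z : C3) : det3 x y z =
    x 0 * y 1 * z 2 - x 0 * y 2 * z 1 - x 1 * y 0 * z 2 + x 1 * y 2 * z 0
      + x 2 * y 0 * z 1 - x 2 * y 1 * z 0 := by
  simp [det3, Matrix.det_fin_three]

theorem contDiffOn_det3 {E : Type*} [NormedAddCommGroup E] [NormedSpace ℝ E] {u v w : E → C3}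
    {U : Set E} (hu : ContDiffOn ℝ ∞ u U) (hv : ContDiffOn ℝ ∞ v U) (hw : ContDiffOn ℝ ∞ w U) :
    ContDiffOn ℝ ∞ (fun x => det3 (u x) (v x) (w x)) U := by
  simp only [det3_eq]
  rw [contDiffOn_pi] at hu hv hw
  have h0 := hu 0; have h1 := hu 1; have h2 := hu 2
  have h3 := hv 0; have h4 := hv 1; have h5 := hv 2
  have h6 := hw 0; have h7 := hw 1; have h8 := hw 2
  fun_prop

/-- The Gram determinant of a flag `x, y` of the type spanned by a null curve and its tangent:
the form has determinant `-1` in the standard basis. -/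
theorem normSq_det3 (x y z : C3) (hx : herm x x = 0) (hxy : herm x y = 0) :
    det3 x y z * starRingEnd ℂ (det3 x y z) = herm y y * (herm x z * herm z x) := by
  have gram : det3 x y z * starRingEnd ℂ (det3 x y z) =
      -(herm x x * herm y y * herm z z - herm x x * herm y z * herm z y
        - herm x y * herm y x * herm z z + herm x y * herm y z * herm z x
        + herm x z * herm y x * herm z y - herm x z * herm y y * herm z x) := by
    simp only [det3_eq, herm, map_add, map_sub, map_mul]
    have hI : Complex.I ^ 2 = -1 := Complex.I_sq
    ring_nf
    simp only [hI]
    ring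
  have hyx : herm y x = 0 := by rw [← conj_herm, hxy, map_zero]
  rw [gram, hx, hxy, hyx]
  ring

/-- The form is nondegenerate along a basis. -/
theorem eq_zero_of_herm_eq_zero {x y z v : C3} (hd : det3 x y z ≠ 0) (h0 : herm x v = 0)
    (h1 : herm y v = 0) (h2 : herm z v = 0) : v = 0 := by
  have hM : (Matrix.of ![x, y, z]).map (starRingEnd ℂ) *ᵥ
      ![Complex.I * v 2, v 1, -Complex.I * v 0] = 0 := by
    ext i
    fin_cases i
    · simp [Matrix.mulVec, dotProduct, Fin.sum_univ_three]
      rw [← h0, herm]; ring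
    · simp [Matrix.mulVec, dotProduct, Fin.sum_univ_three]
      rw [← h1, herm]; ring
    · simp [Matrix.mulVec, dotProduct, Fin.sum_univ_three]
      rw [← h2, herm]; ring
  have hdet : ((Matrix.of ![x, y, z]).map (starRingEnd ℂ)).det ≠ 0 := by
    have : ((Matrix.of ![x, y, z]).map (starRingEnd ℂ)).det = starRingEnd ℂ (det3 x y z) :=
      ((starRingEnd ℂ).map_det _).symm
    rw [this]
    simpa using hd
  have hv := Matrix.eq_zero_of_mulVec_eq_zero hdet hM
  have e0 := congrFun hv 0
  have e1 := congrFun hv 1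
  have e2 := congrFun hv 2
  simp at e0 e1 e2
  ext i
  fin_cases i <;> simp [e0, e1, e2]

/-! ### Lifts of Legendrian curves -/

/-- The linear form on `ℂ³` which is `1` on the image of `homog`; it reads off the factor of a
lift. -/
noncomputable def chartForm (w : C3) : ℂ := w 0 - Complex.I * w 2

theorem chartForm_homog (z : C2) : chartForm (homog z) = 1 := by
  simp only [chartForm, homog]
  simp
  ring_nf
  simp
  ring

/-- The linear part of the affine map `homog`. -/
noncomputable def homogLin (v : C2) : C3 :=
  ![v 0 / 2, Complex.I * v 1 / (Real.sqrt 2 : ℂ), -(Complex.I * v 0) / 2]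

theorem contDiff_homog : ContDiff ℝ ∞ homog := by
  rw [contDiff_pi]
  intro i
  fin_cases i
  · simp [homog]; fun_prop
  · simp [homog]; fun_prop
  · simp [homog]; fun_prop

theorem hasDerivAt_homog {γ : ℝ → C2} {v : C2} {t : ℝ} (h : HasDerivAt γ v t) :
    HasDerivAt (fun u => homog (γ u)) (homogLin v) t := by
  have h0 : HasDerivAt (fun u => γ u 0) (v 0) t :=
    ((EuclideanSpace.proj (𝕜 := ℂ) (0 : Fin 2)).restrictScalars ℝ).hasFDerivAt.comp_hasDerivAt t h
  have h1 : HasDerivAt (fun u => γ u 1) (v 1) t :=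
    ((EuclideanSpace.proj (𝕜 := ℂ) (1 : Fin 2)).restrictScalars ℝ).hasFDerivAt.comp_hasDerivAt t h
  rw [hasDerivAt_pi]
  intro i
  fin_cases i
  · simpa [homog, homogLin] using (h0.const_add 1).div_const 2
  · simpa [homog, homogLin] using (h1.const_mul Complex.I).div_const (Real.sqrt 2 : ℂ)
  · simpa [homog, homogLin] using ((h0.const_sub 1).const_mul Complex.I).div_const 2

theorem sqrt_two_mul_self : (Real.sqrt 2 : ℂ) * (Real.sqrt 2 : ℂ) = 2 := by
  rw [← Complex.ofReal_mul, Real.mul_self_sqrt (by norm_num)]; norm_num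

theorem norm_sq_C2 (z : C2) : ((‖z‖ ^ 2 : ℝ) : ℂ) =
    z 0 * starRingEnd ℂ (z 0) + z 1 * starRingEnd ℂ (z 1) := by
  rw [EuclideanSpace.norm_sq_eq, Fin.sum_univ_two, Complex.mul_conj, Complex.mul_conj,
    Complex.normSq_eq_norm_sq, Complex.normSq_eq_norm_sq]
  push_cast; rfl

/-- The embedding takes the unit sphere to the hyperquadric. -/
theorem herm_homog (z : C2) : herm (homog z) (homog z) = ((‖z‖ ^ 2 - 1 : ℝ) : ℂ) / 2 := by
  rw [Complex.ofReal_sub, norm_sq_C2]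
  have h2 : (Real.sqrt 2 : ℂ) ≠ 0 := by simp
  simp only [herm, homog]
  simp
  have hs : (Real.sqrt 2 : ℂ) ^ 2 = 2 := by rw [pow_two, sqrt_two_mul_self]
  have hc2 : starRingEnd ℂ 2 = 2 := map_ofNat _ 2
  field_simp
  rw [hs]
  simp only [hc2]
  ring_nf
  simp only [Complex.I_sq]
  ring

theorem herm_homogLin (v : C2) : herm (homogLin v) (homogLin v) = ((‖v‖ ^ 2 : ℝ) : ℂ) / 2 := by
  rw [norm_sq_C2]
  have h2 : (Real.sqrt 2 : ℂ) ≠ 0 := by simp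
  simp only [herm, homogLin]
  simp
  have hs : (Real.sqrt 2 : ℂ) ^ 2 = 2 := by rw [pow_two, sqrt_two_mul_self]
  have hc2 : starRingEnd ℂ 2 = 2 := map_ofNat _ 2
  field_simp
  rw [hs]
  simp only [hc2]
  ring_nf
  simp only [Complex.I_sq]
  ring

theorem IsLegendrian.mono {J N : Set ℝ} {γ : ℝ → C2} (h : IsLegendrian J γ) (hNJ : N ⊆ J) :
    IsLegendrian N γ :=
  ⟨h.smooth.mono hNJ, fun t ht => h.mem_sphere t (hNJ ht), fun t ht => h.immersion t (hNJ ht),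
    fun t ht => h.contact t (hNJ ht)⟩

theorem IsNormalizedLift.mono {J N : Set ℝ} {γ : ℝ → C2} {Γ : ℝ → C3}
    (h : IsNormalizedLift J γ Γ) (hNJ : N ⊆ J) : IsNormalizedLift N γ Γ :=
  ⟨h.smooth.mono hNJ, fun t ht => h.lift t (hNJ ht), fun t ht => h.normalized t (hNJ ht)⟩

section Lifts

variable {J : Set ℝ} {γ : ℝ → C2} {Γ : ℝ → C3}

/-- The curve of homogeneous coordinates of a Legendrian curve. -/
noncomputable def homogCurve (γ : ℝ → C2) (t : ℝ) : C3 := homog (γ t)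

theorem IsLegendrian.contDiffOn_homogCurve (h : IsLegendrian J γ) :
    ContDiffOn ℝ ∞ (homogCurve γ) J := contDiff_homog.comp_contDiffOn h.smooth

theorem IsLegendrian.herm_self (h : IsLegendrian J γ) {t : ℝ} (ht : t ∈ J) :
    herm (homogCurve γ t) (homogCurve γ t) = 0 := by
  rw [homogCurve, herm_homog, h.mem_sphere t ht]; simp

theorem IsLegendrian.herm_deriv (h : IsLegendrian J γ) {t : ℝ} (ht : t ∈ J) :
    herm (homogCurve γ t) (iteratedDeriv 1 (homogCurve γ) t) = 0 := by
  rw [iteratedDeriv_one]; exact h.contact t ht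

theorem IsLegendrian.herm_deriv_deriv_ne (h : IsLegendrian J γ) (hJ : IsOpen J) {t : ℝ}
    (ht : t ∈ J) :
    herm (iteratedDeriv 1 (homogCurve γ) t) (iteratedDeriv 1 (homogCurve γ) t) ≠ 0 := by
  have hd := hasDerivAt_of_contDiffOn hJ h.smooth ht
  have hne := h.immersion t ht
  rw [← iteratedDeriv_one] at hne
  have e : iteratedDeriv 1 (homogCurve γ) t = homogLin (iteratedDeriv 1 γ t) := by
    rw [iteratedDeriv_one (f := homogCurve γ)]
    exact (hasDerivAt_homog hd).deriv
  rw [e, herm_homogLin]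
  simpa using hne

/-- A smooth null curve `G` whose velocity is orthogonal to it satisfies `⟨G, G''⟩ = -⟨G', G'⟩`. -/
theorem herm_second (hJ : IsOpen J) {G : ℝ → C3} (hG : ContDiffOn ℝ ∞ G J)
    (h1 : ∀ t ∈ J, herm (G t) (iteratedDeriv 1 G t) = 0) {t : ℝ} (ht : t ∈ J) :
    herm (G t) (iteratedDeriv 2 G t) = -herm (iteratedDeriv 1 G t) (iteratedDeriv 1 G t) := by
  have hd := hasDerivAt_herm (hasDerivAt_of_contDiffOn hJ hG ht)
    (hasDerivAt_iteratedDeriv hJ hG 1 ht)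
  have h0 : HasDerivAt (fun s => herm (G s) (iteratedDeriv 1 G s)) 0 t :=
    (hasDerivAt_const t (0 : ℂ)).congr_of_eventuallyEq
      (Set.EqOn.eventuallyEq_of_mem (s := J) (fun s hs => h1 s hs) (hJ.mem_nhds ht))
  have := hd.unique h0
  linear_combination this

/-- The jets of order at most two of the product of a function and a curve. -/
theorem iteratedDeriv_smul_curve (hJ : IsOpen J) {c : ℝ → ℂ} {G : ℝ → C3}
    (hc : ContDiffOn ℝ ∞ c J) (hG : ContDiffOn ℝ ∞ G J) {t : ℝ} (ht : t ∈ J) :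
    iteratedDeriv 1 (fun s => c s • G s) t = c t • iteratedDeriv 1 G t + iteratedDeriv 1 c t • G t ∧
    iteratedDeriv 2 (fun s => c s • G s) t = c t • iteratedDeriv 2 G t
      + (2 * iteratedDeriv 1 c t) • iteratedDeriv 1 G t + iteratedDeriv 2 c t • G t := by
  have e1 : Set.EqOn (iteratedDeriv 1 (fun s => c s • G s))
      (fun s => c s • iteratedDeriv 1 G s + iteratedDeriv 1 c s • G s) J :=
    iteratedDeriv_succ_eqOn (n := 0) hJ (G := fun s => c s • G s) (fun s _ => by simp)
      (fun s hs => (hasDerivAt_of_contDiffOn hJ hc hs).smul (hasDerivAt_of_contDiffOn hJ hG hs))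
  refine ⟨e1 ht, ?_⟩
  have e2 := iteratedDeriv_succ_eqOn hJ e1 (fun s hs =>
    ((hasDerivAt_of_contDiffOn hJ hc hs).smul (hasDerivAt_iteratedDeriv hJ hG 1 hs)).add
      ((hasDerivAt_iteratedDeriv hJ hc 1 hs).smul (hasDerivAt_of_contDiffOn hJ hG hs)))
  rw [e2 ht]
  module

theorem det3_smul_curve (hJ : IsOpen J) {c : ℝ → ℂ} {G : ℝ → C3}
    (hc : ContDiffOn ℝ ∞ c J) (hG : ContDiffOn ℝ ∞ G J) {t : ℝ} (ht : t ∈ J) :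
    det3 (c t • G t) (iteratedDeriv 1 (fun s => c s • G s) t)
      (iteratedDeriv 2 (fun s => c s • G s) t) =
    c t ^ 3 * det3 (G t) (iteratedDeriv 1 G t) (iteratedDeriv 2 G t) := by
  obtain ⟨h1, h2⟩ := iteratedDeriv_smul_curve hJ hc hG ht
  rw [h1, h2]
  simp only [det3_eq, Pi.add_apply, Pi.smul_apply, smul_eq_mul]
  ring

/-- The jet of a Legendrian curve spans `ℂ³`: by the Gram determinant `|W|² = ⟨Z', Z'⟩³`, and
`⟨Z', Z'⟩ = ‖γ'‖²/2 ≠ 0`. -/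
theorem IsLegendrian.det3_ne_zero (h : IsLegendrian J γ) (hJ : IsOpen J) {t : ℝ} (ht : t ∈ J) :
    det3 (homogCurve γ t) (iteratedDeriv 1 (homogCurve γ) t) (iteratedDeriv 2 (homogCurve γ) t)
      ≠ 0 := by
  intro h0
  have hr := h.herm_deriv_deriv_ne hJ ht
  have hn := normSq_det3 (homogCurve γ t) (iteratedDeriv 1 (homogCurve γ) t)
    (iteratedDeriv 2 (homogCurve γ) t) (h.herm_self ht) (h.herm_deriv ht)
  have hs := herm_second hJ h.contDiffOn_homogCurve (fun t ht => h.herm_deriv ht) ht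
  rw [h0, ← conj_herm (homogCurve γ t), hs] at hn
  simp only [zero_mul, map_neg, conj_herm, neg_mul_neg, zero_eq_mul, mul_self_eq_zero, or_self] at hn
  exact hr hn

theorem contDiffOn_div {E : Type*} [NormedAddCommGroup E] [NormedSpace ℝ E] {f g : E → ℂ}
    {s : Set E} (hf : ContDiffOn ℝ ∞ f s) (hg : ContDiffOn ℝ ∞ g s) (h0 : ∀ x ∈ s, g x ≠ 0) :
    ContDiffOn ℝ ∞ (fun x => f x / g x) s := by
  simp only [div_eq_mul_inv]
  exact hf.mul (hg.inv h0)

/-- A Legendrian curve on an open interval has a normalized lift: the factor is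
`c exp (-⅓ ∫ W'/W)`, where `W` is the determinant of the jet of `homog ∘ γ`. -/
theorem IsLegendrian.exists_normalizedLift (h : IsLegendrian J γ) (hJ : IsOpen J)
    (hJc : J.OrdConnected) (hJn : J.Nonempty) : ∃ Γ, IsNormalizedLift J γ Γ := by
  obtain ⟨t₀, ht₀⟩ := hJn
  set Z := homogCurve γ with hZ
  have hZs : ContDiffOn ℝ ∞ Z J := h.contDiffOn_homogCurve
  set W : ℝ → ℂ := fun t => det3 (Z t) (iteratedDeriv 1 Z t) (iteratedDeriv 2 Z t) with hW
  have hWs : ContDiffOn ℝ ∞ W J :=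
    contDiffOn_det3 hZs (contDiffOn_iteratedDeriv hJ hZs 1) (contDiffOn_iteratedDeriv hJ hZs 2)
  have hW0 : ∀ t ∈ J, W t ≠ 0 := fun t ht => h.det3_ne_zero hJ ht
  set q : ℝ → ℂ := fun t => iteratedDeriv 1 W t / W t with hq
  have hqs : ContDiffOn ℝ ∞ q J := contDiffOn_div (contDiffOn_iteratedDeriv hJ hWs 1) hWs hW0
  set L : ℝ → ℂ := fun t => ∫ u in t₀..t, q u with hL
  have hLd : ∀ t ∈ J, HasDerivAt L (q t) t := fun t ht => by
    have hsub : Set.uIcc t₀ t ⊆ J := hJc.uIcc_subset ht₀ ht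
    refine intervalIntegral.integral_hasDerivAt_right
      ((hqs.continuousOn.mono hsub).intervalIntegrable) ?_
      (hqs.continuousOn.continuousAt (hJ.mem_nhds ht))
    exact hqs.continuousOn.stronglyMeasurableAtFilter hJ t ht
  have hLs : ContDiffOn ℝ ∞ L J := by
    rw [contDiffOn_infty_iff_deriv_of_isOpen hJ]
    exact ⟨fun t ht => (hLd t ht).differentiableAt.differentiableWithinAt,
      hqs.congr fun t ht => (hLd t ht).deriv⟩
  obtain ⟨c₀, hc₀⟩ : ∃ c₀ : ℂ, c₀ ^ 3 = Complex.I / W t₀ :=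
    IsAlgClosed.exists_pow_nat_eq _ (by norm_num)
  set c : ℝ → ℂ := fun t => c₀ * Complex.exp (-(1 / 3) * L t) with hc
  have hcs : ContDiffOn ℝ ∞ c J :=
    contDiffOn_const.mul ((contDiffOn_const.mul hLs).cexp)
  have hcd : ∀ t ∈ J, HasDerivAt c (c t * (-(1 / 3) * q t)) t := fun t ht => by
    have := (((hLd t ht).const_mul (-(1 / 3) : ℂ)).cexp).const_mul c₀
    exact this.congr_deriv (by simp only [hc]; ring)
  have hconst : ∀ t ∈ J, c t ^ 3 * W t = Complex.I := fun t ht => by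
    have hd : ∀ s ∈ J, HasDerivAt (fun t => c t ^ 3 * W t) 0 s := fun s hs => by
      have := ((hcd s hs).pow 3).mul (hasDerivAt_of_contDiffOn hJ hWs hs)
      refine this.congr_deriv ?_
      have := hW0 s hs
      rw [Pi.pow_apply, hq]
      field_simp
      push_cast
      ring
    have := hJ.is_const_of_deriv_eq_zero hJc.isPreconnected
      (fun s hs => (hd s hs).differentiableAt.differentiableWithinAt)
      (fun s hs => (hd s hs).deriv) ht ht₀
    have hc0 : c t₀ = c₀ := by simp [hc, hL]
    have hw := hW0 t₀ ht₀
    rw [this, hc0, hc₀]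
    field_simp
  refine ⟨fun t => c t • Z t, hcs.smul hZs, fun t ht => ⟨c t, ?_, rfl⟩, fun t ht => ?_⟩
  · intro h0
    have := hconst t ht
    rw [h0] at this
    exact Complex.I_ne_zero (by rw [← this]; ring)
  · exact (det3_smul_curve hJ hcs hZs ht).trans (hconst t ht)

theorem normalizedLift_spec (h : IsLegendrian J γ) (hJ : IsOpen J)
    (hJc : J.OrdConnected) (hJn : J.Nonempty) : IsNormalizedLift J γ (normalizedLift J γ) := by
  have hex := h.exists_normalizedLift hJ hJc hJn
  rw [normalizedLift, dif_pos hex]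
  exact hex.choose_spec

theorem contDiff_chartForm : ContDiff ℝ ∞ chartForm := by
  unfold chartForm; fun_prop

theorem IsNormalizedLift.eq_smul (hΓ : IsNormalizedLift J γ Γ) {t : ℝ} (ht : t ∈ J) :
    chartForm (Γ t) ≠ 0 ∧ Γ t = chartForm (Γ t) • homogCurve γ t := by
  obtain ⟨c, hc, h⟩ := hΓ.lift t ht
  have : chartForm (Γ t) = c := by
    have e := chartForm_homog (γ t)
    rw [h]
    simp only [chartForm, Pi.smul_apply, smul_eq_mul] at e ⊢
    linear_combination c * e
  rw [this]
  exact ⟨hc, h⟩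

theorem IsNormalizedLift.contDiffOn_factor (hΓ : IsNormalizedLift J γ Γ) :
    ContDiffOn ℝ ∞ (fun t => chartForm (Γ t)) J :=
  contDiff_chartForm.comp_contDiffOn hΓ.smooth

/-- Two normalized lifts differ by a locally constant cubic root of unity. -/
theorem IsNormalizedLift.unique (hJ : IsOpen J) {Γ' : ℝ → C3}
    (hΓ : IsNormalizedLift J γ Γ) (hΓ' : IsNormalizedLift J γ Γ') {t : ℝ} (ht : t ∈ J) :
    ∃ μ : ℂ, μ ^ 3 = 1 ∧ ∀ k, iteratedDeriv k Γ' t = μ • iteratedDeriv k Γ t := by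
  set μ : ℝ → ℂ := fun s => chartForm (Γ' s) / chartForm (Γ s) with hμ
  have hμs : ContDiffOn ℝ ∞ μ J := contDiffOn_div hΓ'.contDiffOn_factor hΓ.contDiffOn_factor
    fun s hs => (hΓ.eq_smul hs).1
  have heq : Set.EqOn Γ' (fun s => μ s • Γ s) J := fun s hs => by
    obtain ⟨h0, h1⟩ := hΓ.eq_smul hs
    calc Γ' s = chartForm (Γ' s) • homogCurve γ s := (hΓ'.eq_smul hs).2
      _ = μ s • chartForm (Γ s) • homogCurve γ s := by
        rw [smul_smul, div_mul_cancel₀ _ h0]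
      _ = μ s • Γ s := by rw [← h1]
  have hcube : ∀ s ∈ J, μ s ^ 3 = 1 := fun s hs => by
    have h1 := hΓ'.normalized s hs
    have h2 := hΓ.normalized s hs
    rw [iteratedDeriv_eqOn hJ heq 1 hs, iteratedDeriv_eqOn hJ heq 2 hs, heq hs] at h1
    have h3 := det3_smul_curve hJ hμs hΓ.smooth hs
    simp only [det3] at h3
    rw [h1, h2] at h3
    exact mul_right_cancel₀ Complex.I_ne_zero (by rw [← h3, one_mul])
  have hd : ∀ s ∈ J, HasDerivAt μ 0 s := fun s hs => by
    have h1 := hasDerivAt_of_contDiffOn hJ hμs hs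
    have h2 : HasDerivAt (fun r => μ r ^ 3) 0 s :=
      (hasDerivAt_const s (1 : ℂ)).congr_of_eventuallyEq
        (Set.EqOn.eventuallyEq_of_mem (s := J) (fun r hr => hcube r hr) (hJ.mem_nhds hs))
    have h3 := (h1.pow 3).unique h2
    have h4 : μ s ≠ 0 := fun h0 => by simpa [h0] using hcube s hs
    have h5 : iteratedDeriv 1 μ s = 0 := by simpa [h4] using h3
    rwa [h5] at h1
  have key : ∀ k, Set.EqOn (iteratedDeriv k Γ') (fun s => μ s • iteratedDeriv k Γ s) J := by
    intro k
    induction k with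
    | zero => simpa using heq
    | succ k ih =>
      refine iteratedDeriv_succ_eqOn hJ ih fun s hs => ?_
      have := (hd s hs).smul (hasDerivAt_iteratedDeriv hJ hΓ.smooth k hs)
      rw [zero_smul, add_zero] at this
      exact this
  exact ⟨μ t, hcube t ht, fun k => key k ht⟩

/-- The cubic density computed from a lift. -/
noncomputable def cubicOf (Γ : ℝ → C3) (t : ℝ) : ℝ :=
  (herm (iteratedDeriv 3 Γ t) (iteratedDeriv 2 Γ t)).im

/-- The quadratic density computed from a lift. -/
noncomputable def quadraticOf (Γ : ℝ → C3) (t : ℝ) : ℝ :=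
  (herm (iteratedDeriv 2 Γ t) (iteratedDeriv 2 Γ t)).re / 2

/-- The cubic density may be computed from any normalized lift on an open set of parameters. -/
theorem cubicDensity_eq {N : Set ℝ} (hJ : IsOpen J) (hJc : J.OrdConnected)
    (hγ : IsLegendrian J γ) (hN : IsOpen N) (hNJ : N ⊆ J) (hΓ : IsNormalizedLift N γ Γ)
    {t : ℝ} (ht : t ∈ N) : cubicDensity J γ t = cubicOf Γ t := by
  obtain ⟨μ, hμ, h⟩ := hΓ.unique hN
    ((normalizedLift_spec hγ hJ hJc ⟨t, hNJ ht⟩).mono hNJ) ht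
  have hn : ‖μ‖ = 1 := by
    have := congrArg norm hμ
    rw [norm_pow, norm_one] at this
    exact (pow_eq_one_iff_of_nonneg (norm_nonneg _) (by norm_num)).1 this
  have hc : starRingEnd ℂ μ * μ = 1 := by
    rw [Complex.conj_mul', hn]; simp
  rw [cubicDensity, cubicOf, h 3, h 2, herm_smul_left, herm_smul_right, ← mul_assoc, hc, one_mul]

end Lifts

/-! ### The Frenet equations of a normalized lift -/

section Frame

variable {J : Set ℝ} {γ : ℝ → C2} {Γ : ℝ → C3}

/-- Along a smooth curve, a constant product can be differentiated. -/
theorem herm_deriv_of_const (hJ : IsOpen J) {G H : ℝ → C3} {c : ℂ}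
    {G' H' : C3} (h : ∀ t ∈ J, herm (G t) (H t) = c) {t : ℝ} (ht : t ∈ J)
    (hG : HasDerivAt G G' t) (hH : HasDerivAt H H' t) : herm G' (H t) + herm (G t) H' = 0 :=
  (hasDerivAt_herm hG hH).unique ((hasDerivAt_const t c).congr_of_eventuallyEq
    (Set.EqOn.eventuallyEq_of_mem (s := J) h (hJ.mem_nhds ht)))

namespace IsNormalizedLift

theorem herm_self (hγ : IsLegendrian J γ) (hΓ : IsNormalizedLift J γ Γ) {t : ℝ} (ht : t ∈ J) :
    herm (Γ t) (Γ t) = 0 := by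
  rw [(hΓ.eq_smul ht).2, herm_smul_left, herm_smul_right, hγ.herm_self ht]; simp

theorem herm_zero_one (hJ : IsOpen J) (hγ : IsLegendrian J γ) (hΓ : IsNormalizedLift J γ Γ) {t : ℝ}
    (ht : t ∈ J) : herm (Γ t) (iteratedDeriv 1 Γ t) = 0 := by
  have heq : Set.EqOn Γ (fun s => chartForm (Γ s) • homogCurve γ s) J := fun s hs => (hΓ.eq_smul hs).2
  rw [iteratedDeriv_eqOn hJ heq 1 ht,
    (iteratedDeriv_smul_curve hJ hΓ.contDiffOn_factor hγ.contDiffOn_homogCurve ht).1,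
    (hΓ.eq_smul ht).2, herm_add_right, herm_smul_right, herm_smul_right, herm_smul_left,
    herm_smul_left, hγ.herm_self ht, hγ.herm_deriv ht]
  simp

theorem herm_zero_two' (hJ : IsOpen J) (hγ : IsLegendrian J γ) (hΓ : IsNormalizedLift J γ Γ) {t : ℝ}
    (ht : t ∈ J) : herm (Γ t) (iteratedDeriv 2 Γ t) =
      -herm (iteratedDeriv 1 Γ t) (iteratedDeriv 1 Γ t) :=
  herm_second hJ hΓ.smooth (fun _ hs => herm_zero_one hJ hγ hΓ hs) ht

theorem det3_eq_I (hΓ : IsNormalizedLift J γ Γ) {t : ℝ} (ht : t ∈ J) :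
    det3 (Γ t) (iteratedDeriv 1 Γ t) (iteratedDeriv 2 Γ t) = Complex.I := hΓ.normalized t ht

/-- The normalization of the determinant makes the tangent vector of a lift a unit vector. -/
theorem herm_one_one (hJ : IsOpen J) (hγ : IsLegendrian J γ) (hΓ : IsNormalizedLift J γ Γ) {t : ℝ}
    (ht : t ∈ J) : herm (iteratedDeriv 1 Γ t) (iteratedDeriv 1 Γ t) = 1 := by
  have hn := normSq_det3 _ _ (iteratedDeriv 2 Γ t) (herm_self hγ hΓ ht) (herm_zero_one hJ hγ hΓ ht)
  rw [det3_eq_I hΓ ht, ← conj_herm (Γ t), herm_zero_two' hJ hγ hΓ ht, map_neg, conj_herm] at hn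
  set r := herm (iteratedDeriv 1 Γ t) (iteratedDeriv 1 Γ t)
  have hr : starRingEnd ℂ r = r := conj_herm _ _
  obtain ⟨x, hx⟩ := Complex.conj_eq_iff_real.1 hr
  rw [hx] at hn ⊢
  have h3 : x ^ 3 = 1 := by
    have : ((x ^ 3 : ℝ) : ℂ) = 1 := by
      push_cast
      simp at hn
      rw [hn]; ring
    exact_mod_cast this
  have : x = 1 := by
    have h : (x - 1) * (x ^ 2 + x + 1) = 0 := by linear_combination h3
    rcases mul_eq_zero.1 h with h | h
    · linarith
    · nlinarith [sq_nonneg (x + 1 / 2)]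
  rw [this]; simp

theorem herm_zero_two (hJ : IsOpen J) (hγ : IsLegendrian J γ) (hΓ : IsNormalizedLift J γ Γ) {t : ℝ}
    (ht : t ∈ J) : herm (Γ t) (iteratedDeriv 2 Γ t) = -1 := by
  rw [herm_zero_two' hJ hγ hΓ ht, herm_one_one hJ hγ hΓ ht]

/-- The third derivative is in the span of the lift and its velocity, as the determinant is
constant. -/
theorem det3_third (hJ : IsOpen J) (hΓ : IsNormalizedLift J γ Γ) {t : ℝ} (ht : t ∈ J) :
    det3 (Γ t) (iteratedDeriv 1 Γ t) (iteratedDeriv 3 Γ t) = 0 := by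
  have hc : ∀ k i, HasDerivAt (fun s => iteratedDeriv k Γ s i) (iteratedDeriv (k + 1) Γ t i) t :=
    fun k i => hasDerivAt_pi.1 (hasDerivAt_iteratedDeriv hJ hΓ.smooth k ht) i
  have hd : HasDerivAt (fun s => det3 (iteratedDeriv 0 Γ s) (iteratedDeriv 1 Γ s)
      (iteratedDeriv 2 Γ s)) (det3 (Γ t) (iteratedDeriv 1 Γ t) (iteratedDeriv 3 Γ t)) t := by
    simp only [det3_eq]
    refine HasDerivAt.congr_deriv (((((((hc 0 0).fun_mul (hc 1 1)).fun_mul (hc 2 2)).fun_sub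
      (((hc 0 0).fun_mul (hc 1 2)).fun_mul (hc 2 1))).fun_sub
      (((hc 0 1).fun_mul (hc 1 0)).fun_mul (hc 2 2))).fun_add
      (((hc 0 1).fun_mul (hc 1 2)).fun_mul (hc 2 0))).fun_add
      (((hc 0 2).fun_mul (hc 1 0)).fun_mul (hc 2 1)) |>.fun_sub
      (((hc 0 2).fun_mul (hc 1 1)).fun_mul (hc 2 0))) ?_
    simp only [iteratedDeriv_zero]
    ring
  refine hd.unique ((hasDerivAt_const t Complex.I).congr_of_eventuallyEq
    (Set.EqOn.eventuallyEq_of_mem (s := J) (fun s hs => ?_) (hJ.mem_nhds ht)))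
  simpa using det3_eq_I hΓ hs

theorem herm_zero_three (hJ : IsOpen J) (hγ : IsLegendrian J γ) (hΓ : IsNormalizedLift J γ Γ)
    {t : ℝ} (ht : t ∈ J) : herm (Γ t) (iteratedDeriv 3 Γ t) = 0 := by
  have hn := normSq_det3 _ _ (iteratedDeriv 3 Γ t) (herm_self hγ hΓ ht) (herm_zero_one hJ hγ hΓ ht)
  rw [det3_third hJ hΓ ht, herm_one_one hJ hγ hΓ ht, ← conj_herm (Γ t), zero_mul, one_mul,
    Complex.mul_conj] at hn
  simpa using hn.symm

theorem herm_one_two (hJ : IsOpen J) (hγ : IsLegendrian J γ) (hΓ : IsNormalizedLift J γ Γ)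
    {t : ℝ} (ht : t ∈ J) : herm (iteratedDeriv 1 Γ t) (iteratedDeriv 2 Γ t) = 0 := by
  have := herm_deriv_of_const hJ (fun s hs => herm_zero_two hJ hγ hΓ hs) ht
    (hasDerivAt_of_contDiffOn hJ hΓ.smooth ht) (hasDerivAt_iteratedDeriv hJ hΓ.smooth 2 ht)
  simpa [herm_zero_three hJ hγ hΓ ht] using this

theorem herm_two_two (t : ℝ) : herm (iteratedDeriv 2 Γ t) (iteratedDeriv 2 Γ t) =
    ((2 * quadraticOf Γ t : ℝ) : ℂ) := by
  obtain ⟨x, hx⟩ := Complex.conj_eq_iff_real.1 (conj_herm (iteratedDeriv 2 Γ t) (iteratedDeriv 2 Γ t))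
  rw [quadraticOf, hx]
  push_cast
  rw [Complex.ofReal_re]
  ring

theorem herm_one_three (hJ : IsOpen J) (hγ : IsLegendrian J γ) (hΓ : IsNormalizedLift J γ Γ)
    {t : ℝ} (ht : t ∈ J) : herm (iteratedDeriv 1 Γ t) (iteratedDeriv 3 Γ t) =
      -((2 * quadraticOf Γ t : ℝ) : ℂ) := by
  have := herm_deriv_of_const hJ (fun s hs => herm_one_two hJ hγ hΓ hs) ht
    (hasDerivAt_iteratedDeriv hJ hΓ.smooth 1 ht) (hasDerivAt_iteratedDeriv hJ hΓ.smooth 2 ht)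
  rw [← herm_two_two]
  linear_combination this

theorem contDiffOn_quadraticOf (hJ : IsOpen J) (hΓ : IsNormalizedLift J γ Γ) :
    ContDiffOn ℝ ∞ (quadraticOf Γ) J :=
  ((Complex.reCLM.contDiff.comp_contDiffOn (contDiffOn_herm (contDiffOn_iteratedDeriv hJ hΓ.smooth 2)
    (contDiffOn_iteratedDeriv hJ hΓ.smooth 2))).div_const 2)

theorem contDiffOn_cubicOf (hJ : IsOpen J) (hΓ : IsNormalizedLift J γ Γ) :
    ContDiffOn ℝ ∞ (cubicOf Γ) J :=
  Complex.imCLM.contDiff.comp_contDiffOn (contDiffOn_herm (contDiffOn_iteratedDeriv hJ hΓ.smooth 3)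
    (contDiffOn_iteratedDeriv hJ hΓ.smooth 2))

theorem herm_three_two (hJ : IsOpen J) (hΓ : IsNormalizedLift J γ Γ)
    {t : ℝ} (ht : t ∈ J) : herm (iteratedDeriv 3 Γ t) (iteratedDeriv 2 Γ t) =
      ((iteratedDeriv 1 (quadraticOf Γ) t : ℝ) : ℂ) + Complex.I * (cubicOf Γ t : ℂ) := by
  have h2 := hasDerivAt_iteratedDeriv hJ hΓ.smooth 2 ht
  have hd := (Complex.reCLM.hasFDerivAt.comp_hasDerivAt t (hasDerivAt_herm h2 h2)).div_const 2
  have hb := hasDerivAt_of_contDiffOn hJ (contDiffOn_quadraticOf hJ hΓ) ht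
  have e := hb.unique hd
  rw [Complex.reCLM_apply, Complex.add_re, ← conj_herm (iteratedDeriv 3 Γ t), Complex.conj_re] at e
  apply Complex.ext
  · simp [e]
  · simp [cubicOf]

/-- The Frenet equation `Γ''' = (-b' + i a) Γ - 2 b Γ'` of a normalized lift. -/
theorem third_deriv (hJ : IsOpen J) (hγ : IsLegendrian J γ) (hΓ : IsNormalizedLift J γ Γ)
    {t : ℝ} (ht : t ∈ J) : iteratedDeriv 3 Γ t =
      (-((iteratedDeriv 1 (quadraticOf Γ) t : ℝ) : ℂ) + Complex.I * (cubicOf Γ t : ℂ)) • Γ t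
        + (-(2 * quadraticOf Γ t : ℝ) : ℂ) • iteratedDeriv 1 Γ t := by
  rw [← sub_eq_zero, sub_eq_add_neg, ← neg_one_smul ℂ]
  have h32 := herm_three_two hJ hΓ ht
  have h10 : herm (iteratedDeriv 1 Γ t) (Γ t) = 0 := by
    rw [← conj_herm, herm_zero_one hJ hγ hΓ ht, map_zero]
  have h20 : herm (iteratedDeriv 2 Γ t) (Γ t) = -1 := by
    rw [← conj_herm, herm_zero_two hJ hγ hΓ ht]; simp
  have h21 : herm (iteratedDeriv 2 Γ t) (iteratedDeriv 1 Γ t) = 0 := by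
    rw [← conj_herm, herm_one_two hJ hγ hΓ ht, map_zero]
  have hne : det3 (Γ t) (iteratedDeriv 1 Γ t) (iteratedDeriv 2 Γ t) ≠ 0 := by
    rw [det3_eq_I hΓ ht]; exact Complex.I_ne_zero
  refine eq_zero_of_herm_eq_zero hne ?_ ?_ ?_
  · simp only [herm_add_right, herm_smul_right, herm_zero_three hJ hγ hΓ ht, herm_self hγ hΓ ht,
      herm_zero_one hJ hγ hΓ ht]
    ring
  · simp only [herm_add_right, herm_smul_right, herm_one_three hJ hγ hΓ ht,
      herm_one_one hJ hγ hΓ ht, h10]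
    ring
  · rw [herm_add_right, ← conj_herm (iteratedDeriv 3 Γ t), h32]
    simp only [herm_add_right, herm_smul_right, h20, h21, map_add, map_mul, Complex.conj_I,
      Complex.conj_ofReal]
    ring

end IsNormalizedLift
end Frame

/-! ### The linearization of the cubic density -/

section FirstVariation

/-- The skew-adjoint fifth order operator
`D φ = φ⁽⁵⁾ + 10 b φ''' + 15 b' φ'' + (9 b'' + 16 b²) φ' + (2 b''' + 16 b b') φ`, the fourth symmetric
power of `φ'' + (b/2) φ`. -/
noncomputable def fifthOrder (b φ : ℝ → ℝ) (t : ℝ) : ℝ :=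
  iteratedDeriv 5 φ t + 10 * b t * iteratedDeriv 3 φ t + 15 * iteratedDeriv 1 b t * iteratedDeriv 2 φ t
    + (9 * iteratedDeriv 2 b t + 16 * b t ^ 2) * iteratedDeriv 1 φ t
    + (2 * iteratedDeriv 3 b t + 16 * b t * iteratedDeriv 1 b t) * φ t

/-- The contact Hamiltonian of a field `V` along a lift `Γ`: its component transverse to the
contact distribution. -/
noncomputable def contactPart (Γ V : ℝ → C3) (t : ℝ) : ℝ := -(herm (Γ t) (V t)).im

/-- The component of a field `V` along the velocity of a lift `Γ`. -/
noncomputable def tangentPart (Γ V : ℝ → C3) (t : ℝ) : ℝ :=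
  (herm (iteratedDeriv 1 Γ t) (V t)).re

variable {J : Set ℝ} {γ : ℝ → C2} {Γ V : ℝ → C3}

theorem contDiffOn_contactPart (hΓ : ContDiffOn ℝ ∞ Γ J) (hV : ContDiffOn ℝ ∞ V J) :
    ContDiffOn ℝ ∞ (contactPart Γ V) J :=
  (Complex.imCLM.contDiff.comp_contDiffOn (contDiffOn_herm hΓ hV)).neg

theorem contDiffOn_tangentPart (hJ : IsOpen J) (hΓ : ContDiffOn ℝ ∞ Γ J) (hV : ContDiffOn ℝ ∞ V J) :
    ContDiffOn ℝ ∞ (tangentPart Γ V) J :=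
  Complex.reCLM.contDiff.comp_contDiffOn (contDiffOn_herm (contDiffOn_iteratedDeriv hJ hΓ 1) hV)

/-- If two functions agree on an open set, so do their derivatives. -/
theorem deriv_eq_of_eqOn {E : Type*} [NormedAddCommGroup E] [NormedSpace ℝ E] (hJ : IsOpen J)
    {F G : ℝ → E} {F' G' : E} {t : ℝ} (ht : t ∈ J) (h : ∀ s ∈ J, F s = G s)
    (hF : HasDerivAt F F' t) (hG : HasDerivAt G G' t) : F' = G' :=
  hF.unique (hG.congr_of_eventuallyEq (Set.EqOn.eventuallyEq_of_mem (s := J) h (hJ.mem_nhds ht)))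

/-- The linearization of the cubic density. A field `V` along a lift `Γ` which preserves the
relations `⟨Γ, Γ⟩ = ⟨Γ, Γ'⟩ = ⟨Γ', Γ''⟩ = 0` and `⟨Γ', Γ'⟩ = 1` to first order changes `a` by the Lie
derivative along its tangential part plus a sixth of `D` applied to its contact Hamiltonian. The
proof differentiates the products `⟨Γ⁽ᵏ⁾, V⁽ˡ⁾⟩` and eliminates them by the Frenet equation. -/
theorem cubic_linearization (hJ : IsOpen J) (hγ : IsLegendrian J γ) (hΓ : IsNormalizedLift J γ Γ)
    (hV : ContDiffOn ℝ ∞ V J)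
    (L00 : ∀ t ∈ J, herm (V t) (Γ t) + herm (Γ t) (V t) = 0)
    (L01 : ∀ t ∈ J, herm (V t) (iteratedDeriv 1 Γ t) + herm (Γ t) (iteratedDeriv 1 V t) = 0)
    (L11 : ∀ t ∈ J, herm (iteratedDeriv 1 V t) (iteratedDeriv 1 Γ t)
      + herm (iteratedDeriv 1 Γ t) (iteratedDeriv 1 V t) = 0)
    (L12 : ∀ t ∈ J, herm (iteratedDeriv 1 V t) (iteratedDeriv 2 Γ t)
      + herm (iteratedDeriv 1 Γ t) (iteratedDeriv 2 V t) = 0) {t : ℝ} (ht : t ∈ J) :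
    (herm (iteratedDeriv 3 V t) (iteratedDeriv 2 Γ t)
      + herm (iteratedDeriv 3 Γ t) (iteratedDeriv 2 V t)).im =
    tangentPart Γ V t * iteratedDeriv 1 (cubicOf Γ) t
      + 3 * iteratedDeriv 1 (tangentPart Γ V) t * cubicOf Γ t
      + 1 / 6 * fifthOrder (quadraticOf Γ) (contactPart Γ V) t := by
  set a := cubicOf Γ with ha
  set b := quadraticOf Γ with hb
  set h := contactPart Γ V with hh
  set f := tangentPart Γ V with hf
  have da : ∀ k, ∀ t ∈ J, HasDerivAt (iteratedDeriv k a) (iteratedDeriv (k + 1) a t) t :=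
    fun k t ht => hasDerivAt_iteratedDeriv hJ (hΓ.contDiffOn_cubicOf hJ) k ht
  have db : ∀ k, ∀ t ∈ J, HasDerivAt (iteratedDeriv k b) (iteratedDeriv (k + 1) b t) t :=
    fun k t ht => hasDerivAt_iteratedDeriv hJ (hΓ.contDiffOn_quadraticOf hJ) k ht
  have dh : ∀ k, ∀ t ∈ J, HasDerivAt (iteratedDeriv k h) (iteratedDeriv (k + 1) h t) t :=
    fun k t ht => hasDerivAt_iteratedDeriv hJ (contDiffOn_contactPart hΓ.smooth hV) k ht
  have df : ∀ k, ∀ t ∈ J, HasDerivAt (iteratedDeriv k f) (iteratedDeriv (k + 1) f t) t :=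
    fun k t ht => hasDerivAt_iteratedDeriv hJ (contDiffOn_tangentPart hJ hΓ.smooth hV) k ht
  have hb0 : ∀ s, b s = iteratedDeriv 0 b s := fun s => by simp
  set A : ℕ → ℕ → ℝ → ℝ := fun k l s => (herm (iteratedDeriv k Γ s) (iteratedDeriv l V s)).re with hA
  set B : ℕ → ℕ → ℝ → ℝ := fun k l s => (herm (iteratedDeriv k Γ s) (iteratedDeriv l V s)).im with hB
  have dA : ∀ k l, ∀ s ∈ J, HasDerivAt (A k l) (A (k + 1) l s + A k (l + 1) s) s :=
    fun k l s hs => Complex.reCLM.hasFDerivAt.comp_hasDerivAt s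
      (hasDerivAt_herm (hasDerivAt_iteratedDeriv hJ hΓ.smooth k hs)
        (hasDerivAt_iteratedDeriv hJ hV l hs))
  have dB : ∀ k l, ∀ s ∈ J, HasDerivAt (B k l) (B (k + 1) l s + B k (l + 1) s) s :=
    fun k l s hs => Complex.imCLM.hasFDerivAt.comp_hasDerivAt s
      (hasDerivAt_herm (hasDerivAt_iteratedDeriv hJ hΓ.smooth k hs)
        (hasDerivAt_iteratedDeriv hJ hV l hs))
  have B3 : ∀ l, ∀ s ∈ J, B 3 l s = -iteratedDeriv 1 b s * B 0 l s - a s * A 0 l s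
      - 2 * b s * B 1 l s := fun l s hs => by
    simp only [hA, hB, hΓ.third_deriv hJ hγ hs, herm_add_left, herm_smul_left]
    simp
    ring
  have f0 : ∀ s, A 1 0 s = iteratedDeriv 0 f s := fun s => by simp [hA, hf, tangentPart]
  have h0 : ∀ s, B 0 0 s = -iteratedDeriv 0 h s := fun s => by simp [hB, hh, contactPart]
  have A00 : ∀ s ∈ J, A 0 0 s = 0 := fun s hs => by
    have := congrArg Complex.re (L00 s hs)
    rw [← conj_herm (Γ s), Complex.add_re, Complex.conj_re] at this
    simp only [hA, iteratedDeriv_zero]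
    simp at this
    linarith
  have A01 : ∀ s ∈ J, A 0 1 s = -iteratedDeriv 0 f s := fun s hs => by
    have := congrArg Complex.re (L01 s hs)
    rw [← conj_herm (iteratedDeriv 1 Γ s), Complex.add_re, Complex.conj_re] at this
    rw [← f0]
    simp only [hA, iteratedDeriv_zero]
    simp only [Complex.zero_re] at this
    linarith
  have B01' : ∀ s ∈ J, B 0 1 s = B 1 0 s := fun s hs => by
    have := congrArg Complex.im (L01 s hs)
    rw [← conj_herm (iteratedDeriv 1 Γ s), Complex.add_im, Complex.conj_im] at this
    simp only [hB, iteratedDeriv_zero]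
    simp only [Complex.zero_im] at this
    linarith
  have A11 : ∀ s ∈ J, A 1 1 s = 0 := fun s hs => by
    have := congrArg Complex.re (L11 s hs)
    rw [← conj_herm (iteratedDeriv 1 Γ s), Complex.add_re, Complex.conj_re] at this
    simp only [hA]
    simp only [Complex.zero_re] at this
    linarith
  have B12' : ∀ s ∈ J, B 1 2 s = B 2 1 s := fun s hs => by
    have := congrArg Complex.im (L12 s hs)
    rw [← conj_herm (iteratedDeriv 2 Γ s), Complex.add_im, Complex.conj_im] at this
    simp only [hB]
    simp only [Complex.zero_im] at this
    linarith
  have B10 : ∀ s ∈ J, B 1 0 s = -iteratedDeriv 1 h s / 2 := fun s hs => by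
    have := deriv_eq_of_eqOn hJ hs (fun s _ => h0 s) (dB 0 0 s hs) (dh 0 s hs).neg
    have e := B01' s hs
    simp only [zero_add] at this
    linarith
  have B01 : ∀ s ∈ J, B 0 1 s = -iteratedDeriv 1 h s / 2 := fun s hs => by
    rw [B01' s hs, B10 s hs]
  have A02 : ∀ s ∈ J, A 0 2 s = -iteratedDeriv 1 f s := fun s hs => by
    have := deriv_eq_of_eqOn hJ hs A01 (dA 0 1 s hs) (df 0 s hs).neg
    have e := A11 s hs
    simp only [zero_add, Nat.reduceAdd] at this
    linarith
  have B11 : ∀ s ∈ J, B 1 1 s = -iteratedDeriv 2 h s / 2 - B 2 0 s := fun s hs => by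
    have := deriv_eq_of_eqOn hJ hs B10 (dB 1 0 s hs) ((dh 1 s hs).neg.div_const 2)
    simp only [zero_add, Nat.reduceAdd] at this
    linarith
  have B02 : ∀ s ∈ J, B 0 2 s = B 2 0 s := fun s hs => by
    have := deriv_eq_of_eqOn hJ hs B01 (dB 0 1 s hs) ((dh 1 s hs).neg.div_const 2)
    have e := B11 s hs
    simp only [zero_add, Nat.reduceAdd] at this
    linarith
  have B30 : ∀ s ∈ J, B 3 0 s = iteratedDeriv 1 b s * iteratedDeriv 0 h s
      + b s * iteratedDeriv 1 h s := fun s hs => by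
    rw [B3 0 s hs, A00 s hs, h0 s, B10 s hs]; ring
  have B21 : ∀ s ∈ J, B 2 1 s = -(iteratedDeriv 1 b s * iteratedDeriv 0 h s
      + iteratedDeriv 0 b s * iteratedDeriv 1 h s) / 3 - iteratedDeriv 3 h s / 6 := fun s hs => by
    have := deriv_eq_of_eqOn hJ hs B11 (dB 1 1 s hs)
      (((dh 2 s hs).neg.div_const 2).sub (dB 2 0 s hs))
    simp only [zero_add, Nat.reduceAdd] at this
    have e1 := B12' s hs
    have e2 := B30 s hs
    rw [hb0] at e2
    linarith
  have B31 : ∀ s ∈ J, B 3 1 s = iteratedDeriv 1 b s * iteratedDeriv 1 h s / 2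
      + iteratedDeriv 0 a s * iteratedDeriv 0 f s
      + iteratedDeriv 0 b s * (iteratedDeriv 2 h s + 2 * B 2 0 s) := fun s hs => by
    rw [B3 1 s hs, B01 s hs, A01 s hs, B11 s hs, hb0]
    simp only [iteratedDeriv_zero]
    ring
  have B22 : ∀ s ∈ J, B 2 2 s =
      -(iteratedDeriv 2 b s * iteratedDeriv 0 h s + 2 * (iteratedDeriv 1 b s * iteratedDeriv 1 h s)
        + iteratedDeriv 0 b s * iteratedDeriv 2 h s) / 3 - iteratedDeriv 4 h s / 6
      - (iteratedDeriv 1 b s * iteratedDeriv 1 h s / 2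
      + iteratedDeriv 0 a s * iteratedDeriv 0 f s
      + iteratedDeriv 0 b s * (iteratedDeriv 2 h s + 2 * B 2 0 s)) := fun s hs => by
    have := deriv_eq_of_eqOn hJ hs B21 (dB 2 1 s hs)
      ((((db 1 s hs).fun_mul (dh 0 s hs)).fun_add ((db 0 s hs).fun_mul (dh 1 s hs))).fun_neg.div_const 3
        |>.fun_sub ((dh 3 s hs).div_const 6))
    simp only [zero_add, Nat.reduceAdd] at this
    have e1 := B31 s hs
    linarith
  have dB22 := deriv_eq_of_eqOn hJ ht B22 (dB 2 2 t ht)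
    ((((((db 2 t ht).fun_mul (dh 0 t ht)).fun_add
      (((db 1 t ht).fun_mul (dh 1 t ht)).const_mul 2)).fun_add
        ((db 0 t ht).fun_mul (dh 2 t ht))).fun_neg.div_const 3
        |>.fun_sub ((dh 4 t ht).div_const 6)).fun_sub
      (((((db 1 t ht).fun_mul (dh 1 t ht)).div_const 2).fun_add
        ((da 0 t ht).fun_mul (df 0 t ht))).fun_add
        ((db 0 t ht).fun_mul ((dh 2 t ht).fun_add ((dB 2 0 t ht).const_mul 2)))))
  simp only [zero_add, Nat.reduceAdd] at dB22
  have B32 := B3 2 t ht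
  have e1 := B02 t ht
  have e2 := A02 t ht
  have e3 := B12' t ht
  have e4 := B21 t ht
  have e5 := B30 t ht
  have goal_lhs : (herm (iteratedDeriv 3 V t) (iteratedDeriv 2 Γ t)
      + herm (iteratedDeriv 3 Γ t) (iteratedDeriv 2 V t)).im = B 3 2 t - B 2 3 t := by
    rw [← conj_herm (iteratedDeriv 2 Γ t), Complex.add_im, Complex.conj_im]
    simp only [hB]
    ring
  have e6 : B 2 3 t = B 3 2 t + B 2 3 t - B 3 2 t := by ring
  rw [goal_lhs, e6, dB22, B32, e1, e2, e3, e4, e5]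
  simp only [iteratedDeriv_zero, fifthOrder]
  ring

end FirstVariation

/-! ### The stress polynomial and its linear equation -/

section Stress

/-- The multiplier `u = a |a|^(-5/3)`, which is three times the derivative of `|a|^(1/3)` with
respect to `a`. -/
noncomputable def multiplier (a : ℝ → ℝ) (t : ℝ) : ℝ := a t * (a t ^ 2) ^ (-(5 / 6) : ℝ)

theorem multiplier_ne_zero {a : ℝ → ℝ} {t : ℝ} (h : a t ≠ 0) : multiplier a t ≠ 0 :=
  mul_ne_zero h (Real.rpow_pos_of_pos (by positivity) _).ne'

theorem abs_multiplier_pow {a : ℝ → ℝ} {t : ℝ} (h : a t ≠ 0) :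
    |multiplier a t| ^ 3 * a t ^ 2 = 1 := by
  have hp : 0 < a t ^ 2 := by positivity
  have e : ((a t ^ 2) ^ (-(5 / 6) : ℝ)) ^ 6 * (a t ^ 2) ^ 5 = 1 := by
    rw [← Real.rpow_natCast, ← Real.rpow_mul hp.le, ← Real.rpow_natCast (a t ^ 2) 5,
      ← Real.rpow_add hp]
    norm_num
  have h6 : (|multiplier a t| ^ 3 * a t ^ 2) ^ 2 = 1 := by
    have : (|multiplier a t| ^ 3 * a t ^ 2) ^ 2 = (multiplier a t ^ 2) ^ 3 * a t ^ 4 := by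
      rw [← sq_abs (multiplier a t)]; ring
    rw [this, multiplier, ← e]; ring
  exact (pow_eq_one_iff_of_nonneg (by positivity) two_ne_zero).1 h6

variable {J : Set ℝ} {a b : ℝ → ℝ}

theorem contDiffOn_multiplier (ha : ContDiffOn ℝ ∞ a J) (h0 : ∀ t ∈ J, a t ≠ 0) :
    ContDiffOn ℝ ∞ (multiplier a) J :=
  ha.mul ((ha.pow 2).rpow_const_of_ne fun t ht => pow_ne_zero 2 (h0 t ht))

theorem hasDerivAt_multiplier {a' t : ℝ} (ha : HasDerivAt a a' t) (h0 : a t ≠ 0) :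
    HasDerivAt (multiplier a) (multiplier a t * (-(2 / 3) * a') / a t) t := by
  have hp : 0 < a t ^ 2 := by positivity
  refine (ha.fun_mul ((ha.fun_pow 2).rpow_const (p := (-(5 / 6) : ℝ)) (Or.inl hp.ne'))).congr_deriv ?_
  rw [Real.rpow_sub_one hp.ne', multiplier]
  field_simp
  norm_num
  ring

/-- The stress polynomial is, up to a nonvanishing factor, `D u` for the multiplier `u`. -/
theorem fifthOrder_multiplier (hJ : IsOpen J) (ha : ContDiffOn ℝ ∞ a J)
    (h0 : ∀ t ∈ J, a t ≠ 0) {t : ℝ} (ht : t ∈ J) :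
    a t ^ 5 * fifthOrder b (multiplier a) t = 2 * multiplier a t * stressPolynomial a b t := by
  set u := multiplier a with hu
  have da : ∀ k, ∀ s ∈ J, HasDerivAt (iteratedDeriv k a) (iteratedDeriv (k + 1) a s) s :=
    fun k s hs => hasDerivAt_iteratedDeriv hJ ha k hs
  have da0 : ∀ s ∈ J, HasDerivAt a (iteratedDeriv 1 a s) s :=
    fun s hs => hasDerivAt_of_contDiffOn hJ ha hs
  have du : ∀ s ∈ J, HasDerivAt u (u s * (-(2 / 3) * iteratedDeriv 1 a s) / a s) s :=
    fun s hs => hasDerivAt_multiplier (da0 s hs) (h0 s hs)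
  -- By `a u' = -(2/3) a' u`, the `k`-th derivative of `u` is `u P / aᵏ` with `P` a polynomial.
  have step : ∀ (k : ℕ) (P P' : ℝ → ℝ), Set.EqOn (iteratedDeriv k u) (fun s => u s * P s / a s ^ k) J →
      (∀ s ∈ J, HasDerivAt P (P' s) s) → Set.EqOn (iteratedDeriv (k + 1) u)
        (fun s => u s * (a s * P' s - (k + 2 / 3) * iteratedDeriv 1 a s * P s) / a s ^ (k + 1)) J := by
    intro k P P' h hP
    refine iteratedDeriv_succ_eqOn hJ h fun s hs => ?_
    have hne := h0 s hs
    refine (((du s hs).fun_mul (hP s hs)).fun_div ((da0 s hs).fun_pow k) (pow_ne_zero k hne)).congr_deriv ?_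
    rcases k with _ | k
    · simp
      field_simp
      ring
    · simp only [Nat.add_sub_cancel]
      push_cast
      field_simp
      ring
  have e1 := step 0 (fun _ => 1) (fun _ => 0) (fun s _ => by simp) (fun s _ => hasDerivAt_const s 1)
  have e1' : Set.EqOn (iteratedDeriv 1 u)
      (fun s => u s * (-(2 / 3) * iteratedDeriv 1 a s) / a s ^ 1) J := fun s hs => by
    rw [e1 hs]; simp
  have e2 := step 1 _ _ e1' (fun s hs => (da 1 s hs).const_mul _)
  have e2' : Set.EqOn (iteratedDeriv 2 u)
      (fun s => u s * (-(2 / 3) * (a s * iteratedDeriv 2 a s) + 10 / 9 * iteratedDeriv 1 a s ^ 2)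
        / a s ^ 2) J := fun s hs => by
    rw [e2 hs]; push_cast; ring
  have e3 := step 2 _ _ e2' (fun s hs => (((da0 s hs).fun_mul (da 2 s hs)).const_mul _).fun_add
    (((da 1 s hs).fun_pow 2).const_mul _))
  have e3' : Set.EqOn (iteratedDeriv 3 u)
      (fun s => u s * (-(2 / 3) * (a s ^ 2 * iteratedDeriv 3 a s)
        + 10 / 3 * (a s * (iteratedDeriv 1 a s * iteratedDeriv 2 a s))
        + -(80 / 27) * iteratedDeriv 1 a s ^ 3) / a s ^ 3) J := fun s hs => by
    rw [e3 hs]; push_cast; ring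
  have e4 := step 3 _ _ e3' (fun s hs =>
    (((((da0 s hs).fun_pow 2).fun_mul (da 3 s hs)).const_mul _).fun_add
      (((da0 s hs).fun_mul ((da 1 s hs).fun_mul (da 2 s hs))).const_mul _)).fun_add
    (((da 1 s hs).fun_pow 3).const_mul _))
  have e4' : Set.EqOn (iteratedDeriv 4 u)
      (fun s => u s * (-(2 / 3) * (a s ^ 3 * iteratedDeriv 4 a s)
        + 40 / 9 * (a s ^ 2 * (iteratedDeriv 1 a s * iteratedDeriv 3 a s))
        + 10 / 3 * (a s ^ 2 * iteratedDeriv 2 a s ^ 2)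
        + -(160 / 9) * (a s * (iteratedDeriv 1 a s ^ 2 * iteratedDeriv 2 a s))
        + 880 / 81 * iteratedDeriv 1 a s ^ 4) / a s ^ 4) J := fun s hs => by
    rw [e4 hs]; push_cast; ring
  have e5 := step 4 _ _ e4' (fun s hs =>
    (((((((da0 s hs).fun_pow 3).fun_mul (da 4 s hs)).const_mul _).fun_add
      ((((da0 s hs).fun_pow 2).fun_mul ((da 1 s hs).fun_mul (da 3 s hs))).const_mul _)).fun_add
      ((((da0 s hs).fun_pow 2).fun_mul ((da 2 s hs).fun_pow 2)).const_mul _)).fun_add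
      (((da0 s hs).fun_mul (((da 1 s hs).fun_pow 2).fun_mul (da 2 s hs))).const_mul _)).fun_add
    (((da 1 s hs).fun_pow 4).const_mul _))
  have hne := h0 t ht
  simp only [fifthOrder, stressPolynomial]
  rw [e5 ht, e3' ht, e2' ht, e1' ht]
  push_cast
  field_simp
  ring

/-- The bilinear concomitant of the skew-adjoint operator `D`. -/
noncomputable def concomitant (b u φ : ℝ → ℝ) (t : ℝ) : ℝ :=
  u t * iteratedDeriv 4 φ t - iteratedDeriv 1 u t * iteratedDeriv 3 φ t
    + iteratedDeriv 2 u t * iteratedDeriv 2 φ t - iteratedDeriv 3 u t * iteratedDeriv 1 φ t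
    + iteratedDeriv 4 u t * φ t
    + 10 * b t * (u t * iteratedDeriv 2 φ t - iteratedDeriv 1 u t * iteratedDeriv 1 φ t
      + iteratedDeriv 2 u t * φ t)
    + 5 * iteratedDeriv 1 b t * (iteratedDeriv 1 u t * φ t + u t * iteratedDeriv 1 φ t)
    + (4 * iteratedDeriv 2 b t + 16 * b t ^ 2) * (u t * φ t)

/-- Skew-adjointness of `D`. -/
theorem hasDerivAt_concomitant (hJ : IsOpen J) {u φ : ℝ → ℝ} (hb : ContDiffOn ℝ ∞ b J)
    (hu : ContDiffOn ℝ ∞ u J) (hφ : ContDiffOn ℝ ∞ φ J) {t : ℝ} (ht : t ∈ J) :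
    HasDerivAt (concomitant b u φ) (u t * fifthOrder b φ t + φ t * fifthOrder b u t) t := by
  have dk : ∀ {F : ℝ → ℝ}, ContDiffOn ℝ ∞ F J → ∀ k, HasDerivAt (iteratedDeriv k F)
    (iteratedDeriv (k + 1) F t) t := fun hF k => hasDerivAt_iteratedDeriv hJ hF k ht
  have b0 := hasDerivAt_of_contDiffOn hJ hb ht
  have u0 := hasDerivAt_of_contDiffOn hJ hu ht
  have p0 := hasDerivAt_of_contDiffOn hJ hφ ht
  refine HasDerivAt.congr_deriv
    (((((((((u0.fun_mul (dk hφ 4)).fun_sub ((dk hu 1).fun_mul (dk hφ 3))).fun_add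
    ((dk hu 2).fun_mul (dk hφ 2))).fun_sub ((dk hu 3).fun_mul (dk hφ 1))).fun_add
    ((dk hu 4).fun_mul p0)).fun_add
    ((b0.const_mul 10).fun_mul (((u0.fun_mul (dk hφ 2)).fun_sub ((dk hu 1).fun_mul (dk hφ 1))).fun_add
      ((dk hu 2).fun_mul p0)))).fun_add
    (((dk hb 1).const_mul 5).fun_mul (((dk hu 1).fun_mul p0).fun_add (u0.fun_mul (dk hφ 1)))))).fun_add
    ((((dk hb 2).const_mul 4).fun_add ((b0.fun_pow 2).const_mul 16)).fun_mul (u0.fun_mul p0))) ?_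
  simp only [fifthOrder]
  norm_num
  ring

/-- A solution `u` of a linear equation `D u = 0` with continuous coefficients stays bounded on a
half-open segment `[p, q)`, by Grönwall's inequality. -/
theorem bounded_of_fifthOrder_eq_zero (hb : ContDiffOn ℝ ∞ b J) (hJ : IsOpen J) {p q : ℝ}
    (hpq : ∀ x ∈ Set.Icc (0 : ℝ) 1, p + x * (q - p) ∈ J) {u : ℝ → ℝ}
    {N : Set ℝ} (hN : IsOpen N) (hu : ContDiffOn ℝ ∞ u N)
    (hpqN : ∀ x ∈ Set.Ico (0 : ℝ) 1, p + x * (q - p) ∈ N) (hD : ∀ t ∈ N, fifthOrder b u t = 0) :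
    ∃ M, ∀ x ∈ Set.Ico (0 : ℝ) 1, |u (p + x * (q - p))| ≤ M := by
  set ℓ : ℝ → ℝ := fun x => p + x * (q - p) with hℓ
  have hℓd : ∀ x, HasDerivAt ℓ (q - p) x := fun x =>
    (((hasDerivAt_id x).mul_const (q - p)).const_add p).congr_deriv (one_mul _)
  have hℓc : Continuous ℓ := by fun_prop
  have hbk : ∀ k, ContinuousOn (iteratedDeriv k b) J := fun k =>
    (contDiffOn_iteratedDeriv hJ hb k).continuousOn
  -- The derivatives of `u` of order at most `4` form a first order linear system.
  set c : ℝ → ℝ := fun t => 10 * |b t| + 15 * |iteratedDeriv 1 b t|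
    + |9 * iteratedDeriv 2 b t + 16 * b t ^ 2|
    + |2 * iteratedDeriv 3 b t + 16 * b t * iteratedDeriv 1 b t| with hc
  have hcJ : ContinuousOn c J := by
    have := hb.continuousOn
    have h1 := hbk 1
    have h2 := hbk 2
    have h3 := hbk 3
    fun_prop
  obtain ⟨C, hC⟩ := isCompact_Icc.exists_bound_of_continuousOn
    (hcJ.comp (hℓc.continuousOn (s := Set.Icc (0 : ℝ) 1)) hpq)
  have hC0 : 0 ≤ C := (norm_nonneg _).trans (hC 0 (by simp))
  set Y : ℝ → Fin 5 → ℝ := fun x i => iteratedDeriv i u (ℓ x) with hY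
  have hYd : ∀ x ∈ Set.Ico (0 : ℝ) 1, HasDerivAt Y
      (fun i : Fin 5 => iteratedDeriv (i + 1) u (ℓ x) * (q - p)) x := fun x hx => by
    rw [hasDerivAt_pi]
    intro i
    have := HasDerivAt.comp x (hasDerivAt_iteratedDeriv hN hu i (hpqN x hx)) (hℓd x)
    exact this
  have hYi : ∀ x (i : ℕ) (hi : i < 5), |iteratedDeriv i u (ℓ x)| ≤ ‖Y x‖ := fun x i hi =>
    norm_le_pi_norm (Y x) ⟨i, hi⟩
  have hbound : ∀ x ∈ Set.Ico (0 : ℝ) 1, ‖fun i : Fin 5 => iteratedDeriv (i + 1) u (ℓ x) * (q - p)‖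
      ≤ ((1 + C) * |q - p|) * ‖Y x‖ + 0 := fun x hx => by
    have hcx : c (ℓ x) ≤ C := (le_abs_self _).trans (hC x ⟨hx.1, hx.2.le⟩)
    have hlast : |iteratedDeriv 5 u (ℓ x)| ≤ C * ‖Y x‖ := by
      have h5 : iteratedDeriv 5 u (ℓ x) = -(10 * b (ℓ x) * iteratedDeriv 3 u (ℓ x)
          + 15 * iteratedDeriv 1 b (ℓ x) * iteratedDeriv 2 u (ℓ x)
          + (9 * iteratedDeriv 2 b (ℓ x) + 16 * b (ℓ x) ^ 2) * iteratedDeriv 1 u (ℓ x)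
          + (2 * iteratedDeriv 3 b (ℓ x) + 16 * b (ℓ x) * iteratedDeriv 1 b (ℓ x)) * u (ℓ x)) := by
        have := hD _ (hpqN x hx)
        simp only [fifthOrder] at this
        linarith
      have e0 : |u (ℓ x)| ≤ ‖Y x‖ := by simpa using hYi x 0 (by norm_num)
      have e1 := hYi x 1 (by norm_num)
      have e2 := hYi x 2 (by norm_num)
      have e3 := hYi x 3 (by norm_num)
      rw [h5, abs_neg]
      refine le_trans ?_ (mul_le_mul_of_nonneg_right hcx (norm_nonneg _))
      have hsplit : c (ℓ x) * ‖Y x‖ = 10 * |b (ℓ x)| * ‖Y x‖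
          + 15 * |iteratedDeriv 1 b (ℓ x)| * ‖Y x‖
          + |9 * iteratedDeriv 2 b (ℓ x) + 16 * b (ℓ x) ^ 2| * ‖Y x‖
          + |2 * iteratedDeriv 3 b (ℓ x) + 16 * b (ℓ x) * iteratedDeriv 1 b (ℓ x)| * ‖Y x‖ := by
        simp only [hc]; ring
      rw [hsplit]
      refine (abs_add_le _ _).trans (add_le_add ((abs_add_le _ _).trans (add_le_add
        ((abs_add_le _ _).trans (add_le_add ?_ ?_)) ?_)) ?_)
      · rw [abs_mul, abs_mul, abs_of_pos (by norm_num : (0 : ℝ) < 10)]; gcongr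
      · rw [abs_mul, abs_mul, abs_of_pos (by norm_num : (0 : ℝ) < 15)]; gcongr
      · rw [abs_mul]; gcongr
      · rw [abs_mul]; gcongr
    rw [add_zero, pi_norm_le_iff_of_nonneg (by positivity)]
    intro i
    rw [Real.norm_eq_abs, abs_mul]
    have hi : |iteratedDeriv (i + 1) u (ℓ x)| ≤ (1 + C) * ‖Y x‖ := by
      have hn := norm_nonneg (Y x)
      rcases Nat.lt_or_ge ((i : ℕ) + 1) 5 with h | h
      · nlinarith [hYi x _ h]
      · have : (i : ℕ) + 1 = 5 := by omega
        rw [this]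
        nlinarith
    nlinarith [abs_nonneg (q - p)]
  refine ⟨‖Y 0‖ * Real.exp ((1 + C) * |q - p|), fun x hx => ?_⟩
  have hg := norm_le_gronwallBound_of_norm_deriv_right_le (f := Y) (a := 0) (b := x)
    (δ := ‖Y 0‖) (K := (1 + C) * |q - p|) (ε := 0)
    (fun y hy => (hYd y ⟨hy.1, hy.2.trans_lt hx.2⟩).continuousAt.continuousWithinAt)
    (fun y hy => (hYd y ⟨hy.1, hy.2.trans hx.2⟩).hasDerivWithinAt) le_rfl
    (fun y hy => hbound y ⟨hy.1, hy.2.trans hx.2⟩) x ⟨hx.1, le_rfl⟩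
  rw [gronwallBound_ε0, sub_zero] at hg
  have h0 : |u (ℓ x)| ≤ ‖Y x‖ := by simpa using hYi x 0 (by norm_num)
  refine h0.trans (hg.trans ?_)
  exact mul_le_mul_of_nonneg_left (Real.exp_le_exp.2
    (mul_le_of_le_one_right (by positivity) hx.2.le)) (norm_nonneg _)

/-- If `D u = 0` wherever `a ≠ 0`, then `a` vanishes identically or nowhere: the solution `u` cannot
blow up, while `|u|³ a² = 1`. -/
theorem eq_zero_or_ne_zero_of_fifthOrder (hJ : IsOpen J) (hJc : J.OrdConnected)
    (ha : ContDiffOn ℝ ∞ a J) (hb : ContDiffOn ℝ ∞ b J)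
    (hD : ∀ t ∈ J, a t ≠ 0 → fifthOrder b (multiplier a) t = 0) :
    (∀ t ∈ J, a t = 0) ∨ (∀ t ∈ J, a t ≠ 0) := by
  by_contra hcon
  push Not at hcon
  obtain ⟨⟨p, hp, hap⟩, r, hr, har⟩ := hcon
  -- The zero of `a` nearest to `p` on the segment from `p` to `r`.
  have hsub : Set.uIcc p r ⊆ J := hJc.uIcc_subset hp hr
  have hcl : IsCompact {t | t ∈ Set.uIcc p r ∧ a t = 0} := by
    have := (ha.continuousOn.mono hsub).preimage_isClosed_of_isClosed isClosed_Icc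
      (isClosed_singleton (x := (0 : ℝ)))
    exact isCompact_uIcc.of_isClosed_subset this (fun t ht => ht.1)
  obtain ⟨q, ⟨hq, haq⟩, hmin⟩ := hcl.exists_isMinOn (f := fun t => |t - p|)
    ⟨r, Set.right_mem_uIcc, har⟩ (by fun_prop)
  have hseg : ∀ x ∈ Set.Icc (0 : ℝ) 1, p + x * (q - p) ∈ Set.uIcc p r := fun x hx => by
    have : Set.uIcc p q ⊆ Set.uIcc p r := Set.uIcc_subset_uIcc Set.left_mem_uIcc hq
    refine this (segment_eq_uIcc p q ▸ ?_)
    rw [segment_eq_image']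
    exact ⟨x, hx, by simp⟩
  have hqp : q ≠ p := fun h => hap (h ▸ haq)
  have hne : ∀ x ∈ Set.Ico (0 : ℝ) 1, a (p + x * (q - p)) ≠ 0 := fun x hx h => by
    have := hmin (show p + x * (q - p) ∈ {t | t ∈ Set.uIcc p r ∧ a t = 0} from
      ⟨hseg x ⟨hx.1, hx.2.le⟩, h⟩)
    simp only [Set.mem_ofPred_eq, add_sub_cancel_left, abs_mul, abs_of_nonneg hx.1] at this
    have hpos := abs_pos.2 (sub_ne_zero.2 hqp)
    nlinarith [hx.2]
  set N : Set ℝ := {t | t ∈ J ∧ a t ≠ 0} with hN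
  have hNo : IsOpen N := ha.continuousOn.isOpen_inter_preimage hJ isOpen_ne
  obtain ⟨M, hM⟩ := bounded_of_fifthOrder_eq_zero hb hJ (fun x hx => hsub (hseg x hx)) hNo
    (contDiffOn_multiplier (ha.mono fun t ht => ht.1) (fun t ht => ht.2))
    (fun x hx => ⟨hsub (hseg x ⟨hx.1, hx.2.le⟩), hne x hx⟩) (fun t ht => hD t ht.1 ht.2)
  have hlow : ∀ x ∈ Set.Ico (0 : ℝ) 1, 1 ≤ M ^ 3 * a (p + x * (q - p)) ^ 2 := fun x hx => by
    rw [← abs_multiplier_pow (hne x hx)]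
    gcongr
    exact hM x hx
  have hlim : Filter.Tendsto (fun x : ℝ => M ^ 3 * a (p + x * (q - p)) ^ 2) (nhdsWithin 1 (Set.Iio 1))
      (nhds (M ^ 3 * a q ^ 2)) := by
    have hcq : ContinuousAt a q := ha.continuousOn.continuousAt (hJ.mem_nhds (hsub hq))
    have hl : Filter.Tendsto (fun x : ℝ => p + x * (q - p)) (nhdsWithin 1 (Set.Iio 1)) (nhds q) := by
      have : Continuous (fun x : ℝ => p + x * (q - p)) := by fun_prop
      have h1 := this.tendsto 1
      simp only [one_mul, add_sub_cancel] at h1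
      exact h1.mono_left nhdsWithin_le_nhds
    exact ((hcq.tendsto.comp hl).pow 2).const_mul _
  have h1 : (1 : ℝ) ≤ M ^ 3 * a q ^ 2 := by
    refine ge_of_tendsto hlim ?_
    filter_upwards [Ioo_mem_nhdsLT (show (0 : ℝ) < 1 by norm_num)] with x hx
    exact hlow x ⟨hx.1.le, hx.2⟩
  rw [haq] at h1
  norm_num at h1

end Stress

/-! ### Joint lifts of families -/

section JointLift

/-- A lift `G`, on an open neighbourhood `U` of `J × {0}`, of a family `g` of Legendrian curves,
which is normalized at each parameter of the family and extends a given normalized lift `Γ₀`. The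
last clause says that the velocity of `G` in the family is, modulo `Γ₀`, the lift of the variation
field. -/
structure IsJointLift (J : Set ℝ) (Γ₀ : ℝ → C3) (g : ℝ → ℝ → C2) (U : Set (ℝ × ℝ))
    (G : ℝ × ℝ → C3) : Prop where
  isOpen : IsOpen U
  fst_mem : ∀ x ∈ U, x.1 ∈ J
  slice_zero : slice U 0 = J
  smooth : ContDiffOn ℝ ∞ G U
  legendrian : ∀ s, IsLegendrian (slice U s) (fun t => g t s)
  normalized : ∀ s, IsNormalizedLift (slice U s) (fun t => g t s) (fun t => G (t, s))
  initial : ∀ t ∈ J, G (t, 0) = Γ₀ t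
  field : ∀ t ∈ J, ∃ k : ℂ, partialS G (t, 0) =
    k • Γ₀ t + chartForm (Γ₀ t) • homogLin (variationField g t)

variable {J : Set ℝ} {Γ₀ : ℝ → C3} {g : ℝ → ℝ → C2} {ε : ℝ}

/-- A smooth family of Legendrian curves has a joint normalized lift near the initial curve: the
lift `Γ₀ = c₀ homog (g · 0)` is extended by `c₀(t) homog (g t s)` and divided by the principal cube
root of `W/i`, where `W` is the determinant of its jet. -/
theorem exists_isJointLift (hJ : IsOpen J) (hε : 0 < ε)
    (hg : ContDiffOn ℝ ∞ (fun x : ℝ × ℝ => g x.1 x.2) (J ×ˢ Set.Ioo (-ε) ε))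
    (hleg : ∀ s ∈ Set.Ioo (-ε) ε, IsLegendrian J (fun t => g t s))
    (hΓ₀ : IsNormalizedLift J (fun t => g t 0) Γ₀) :
    ∃ U G, IsJointLift J Γ₀ g U G := by
  set Ω : Set (ℝ × ℝ) := J ×ˢ Set.Ioo (-ε) ε with hΩ
  have hΩo : IsOpen Ω := hJ.prod isOpen_Ioo
  have h0 : (0 : ℝ) ∈ Set.Ioo (-ε) ε := ⟨by linarith, hε⟩
  set Z : ℝ × ℝ → C3 := fun x => chartForm (Γ₀ x.1) • homog (g x.1 x.2) with hZ
  have hZs : ContDiffOn ℝ ∞ Z Ω :=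
    (hΓ₀.contDiffOn_factor.comp contDiff_fst.contDiffOn (fun x hx => hx.1)).smul
      (contDiff_homog.comp_contDiffOn hg)
  have hZ0 : ∀ t ∈ J, Z (t, 0) = Γ₀ t := fun t ht => (hΓ₀.eq_smul ht).2.symm
  set W : ℝ × ℝ → ℂ := fun x => det3 (Z x) (partialT^[1] Z x) (partialT^[2] Z x) with hW
  have hWs : ContDiffOn ℝ ∞ W Ω := contDiffOn_det3 hZs (contDiffOn_iterate_partialT hΩo hZs 1)
    (contDiffOn_iterate_partialT hΩo hZs 2)
  have hWslice : ∀ t s, (t, s) ∈ Ω → W (t, s) = det3 (Z (t, s))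
      (iteratedDeriv 1 (fun t => Z (t, s)) t) (iteratedDeriv 2 (fun t => Z (t, s)) t) :=
    fun t s hts => by
      rw [iteratedDeriv_slice hΩo hZs 1 s hts, iteratedDeriv_slice hΩo hZs 2 s hts]
  have hW0 : ∀ t ∈ J, W (t, 0) = Complex.I := fun t ht => by
    have he : Set.EqOn (fun t => Z (t, 0)) Γ₀ J := fun t ht => hZ0 t ht
    rw [hWslice t 0 ⟨ht, h0⟩, iteratedDeriv_eqOn hJ he 1 ht, iteratedDeriv_eqOn hJ he 2 ht,
      hZ0 t ht]
    exact hΓ₀.normalized t ht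
  set U : Set (ℝ × ℝ) := Ω ∩ (fun x => W x / Complex.I) ⁻¹' Complex.slitPlane with hU
  have hUo : IsOpen U := (hWs.continuousOn.div_const _).isOpen_inter_preimage hΩo
    Complex.isOpen_slitPlane
  have hUΩ : U ⊆ Ω := Set.inter_subset_left
  have hU0 : ∀ t ∈ J, (t, (0 : ℝ)) ∈ U := fun t ht => by
    refine ⟨⟨ht, h0⟩, ?_⟩
    simp only [Set.mem_preimage, hW0 t ht, div_self Complex.I_ne_zero]
    exact Complex.one_mem_slitPlane
  set m : ℝ × ℝ → ℂ := fun x => Complex.exp (-(1 / 3) * Complex.log (W x / Complex.I)) with hm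
  have hms : ContDiffOn ℝ ∞ m U := by
    have hl : ContDiffOn ℝ ∞ (fun x => Complex.log (W x / Complex.I)) U := fun x hx =>
      ContDiffAt.comp_contDiffWithinAt (g := Complex.log) (f := fun x => W x / Complex.I) x
        ((Complex.contDiffAt_log hx.2).restrict_scalars ℝ) (((hWs.mono hUΩ).div_const _) x hx)
    exact (contDiffOn_const.mul hl).cexp
  have hm3 : ∀ x ∈ U, m x ^ 3 * W x = Complex.I := fun x hx => by
    have hne : W x / Complex.I ≠ 0 := Complex.slitPlane_ne_zero hx.2
    have e : m x ^ 3 = (W x / Complex.I)⁻¹ := by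
      rw [hm, ← Complex.exp_nat_mul]
      push_cast
      rw [show (3 : ℂ) * (-(1 / 3) * Complex.log (W x / Complex.I))
        = -Complex.log (W x / Complex.I) by ring, Complex.exp_neg, Complex.exp_log hne]
    rw [e, inv_div, div_mul_cancel₀]
    intro hw
    simp [hw] at hne
  have hm0 : ∀ t ∈ J, m (t, 0) = 1 := fun t ht => by
    simp [hm, hW0 t ht]
  have hsl : slice U 0 = J := Set.Subset.antisymm (fun t ht => (hUΩ ht).1) hU0
  have hleg' : ∀ s, IsLegendrian (slice U s) (fun t => g t s) := fun s => by
    by_cases hs : s ∈ Set.Ioo (-ε) ε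
    · exact (hleg s hs).mono fun t ht => (hUΩ ht).1
    · have : ∀ t ∈ slice U s, False := fun t ht => hs (hUΩ ht).2
      exact ⟨fun t ht => (this t ht).elim, fun t ht => (this t ht).elim,
        fun t ht => (this t ht).elim, fun t ht => (this t ht).elim⟩
  have hGs : ContDiffOn ℝ ∞ (fun x => m x • Z x) U := hms.smul (hZs.mono hUΩ)
  refine ⟨U, fun x => m x • Z x, hUo, fun x hx => (hUΩ hx).1, hsl, hGs, hleg', fun s => ⟨?_, ?_, ?_⟩, ?_, ?_⟩
  · exact contDiffOn_slice hGs s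
  · intro t ht
    refine ⟨m (t, s) * chartForm (Γ₀ t), mul_ne_zero (Complex.exp_ne_zero _)
      (hΓ₀.eq_smul (hUΩ ht).1).1, ?_⟩
    simp only [hZ, smul_smul]
  · intro t ht
    refine (det3_smul_curve (isOpen_slice hUo s) (contDiffOn_slice hms s)
      (contDiffOn_slice (hZs.mono hUΩ) s) ht).trans ?_
    rw [← hWslice t s (hUΩ ht)]
    exact hm3 _ ht
  · intro t ht
    simp only [hm0 t ht, one_smul, hZ0 t ht]
  · intro t ht
    refine ⟨partialS m (t, 0), ?_⟩
    have d1 := hasDerivAt_partialS hUo hms (hU0 t ht)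
    have hgd : HasDerivAt (fun s => g t s) (variationField g t) 0 :=
      (hasDerivAt_partialS hΩo hg ⟨ht, h0⟩).differentiableAt.hasDerivAt
    have d2 : HasDerivAt (fun s => Z (t, s)) (chartForm (Γ₀ t) • homogLin (variationField g t)) 0 :=
      (hasDerivAt_homog hgd).const_smul (chartForm (Γ₀ t))
    have d3 := hasDerivAt_partialS hUo hGs (hU0 t ht)
    have := d3.unique (d1.smul d2)
    rw [this, hm0 t ht, hZ0 t ht, one_smul, add_comm]

/-- The contact Hamiltonian of the variation field of a family of curves. -/
noncomputable def hamiltonian (Γ₀ : ℝ → C3) (g : ℝ → ℝ → C2) (t : ℝ) : ℝ :=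
  -(chartForm (Γ₀ t) * herm (Γ₀ t) (homogLin (variationField g t))).im

/-- The tangential component of the variation field of a family of curves. -/
noncomputable def drift (Γ₀ : ℝ → C3) (g : ℝ → ℝ → C2) (t : ℝ) : ℝ :=
  (chartForm (Γ₀ t) * herm (iteratedDeriv 1 Γ₀ t) (homogLin (variationField g t))).re

namespace IsJointLift

variable {U : Set (ℝ × ℝ)} {G : ℝ × ℝ → C3}

theorem mem_zero (h : IsJointLift J Γ₀ g U G) {t : ℝ} (ht : t ∈ J) : (t, (0 : ℝ)) ∈ U := by
  have := h.slice_zero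
  rw [← this] at ht
  exact ht

theorem normalized_zero (h : IsJointLift J Γ₀ g U G) :
    IsNormalizedLift J (fun t => g t 0) (fun t => G (t, 0)) := h.slice_zero ▸ h.normalized 0

theorem legendrian_zero (h : IsJointLift J Γ₀ g U G) : IsLegendrian J (fun t => g t 0) :=
  h.slice_zero ▸ h.legendrian 0

theorem contDiffOn_field (h : IsJointLift J Γ₀ g U G) :
    ContDiffOn ℝ ∞ (fun t => partialS G (t, 0)) J :=
  h.slice_zero ▸ contDiffOn_slice (contDiffOn_partialS h.isOpen h.smooth) 0

theorem iteratedDeriv_initial (h : IsJointLift J Γ₀ g U G) (hJ : IsOpen J) (k : ℕ) :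
    Set.EqOn (iteratedDeriv k (fun t => G (t, 0))) (iteratedDeriv k Γ₀) J :=
  iteratedDeriv_eqOn hJ (fun t ht => h.initial t ht) k

theorem hamiltonian_eq (h : IsJointLift J Γ₀ g U G) {t : ℝ} (ht : t ∈ J) :
    hamiltonian Γ₀ g t = contactPart (fun t => G (t, 0)) (fun t => partialS G (t, 0)) t := by
  obtain ⟨k, hk⟩ := h.field t ht
  have h0 := h.normalized_zero.herm_self h.legendrian_zero ht
  simp only [h.initial t ht] at h0
  simp only [hamiltonian, contactPart, hk, h.initial t ht, herm_add_right, herm_smul_right, h0,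
    mul_zero, zero_add]

theorem drift_eq (h : IsJointLift J Γ₀ g U G) (hJ : IsOpen J) {t : ℝ} (ht : t ∈ J) :
    drift Γ₀ g t = tangentPart (fun t => G (t, 0)) (fun t => partialS G (t, 0)) t := by
  obtain ⟨k, hk⟩ := h.field t ht
  have h0 := h.normalized_zero.herm_zero_one hJ h.legendrian_zero ht
  rw [← conj_herm, map_eq_zero, h.iteratedDeriv_initial hJ 1 ht, h.initial t ht] at h0
  simp only [drift, tangentPart, hk, h.iteratedDeriv_initial hJ 1 ht, herm_add_right,
    herm_smul_right, h0, mul_zero, zero_add]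

/-- The cubic densities of the curves of a family, as a function of two variables. -/
noncomputable def cubic (G : ℝ × ℝ → C3) (x : ℝ × ℝ) : ℝ :=
  (herm (partialT^[3] G x) (partialT^[2] G x)).im

theorem contDiffOn_cubic (h : IsJointLift J Γ₀ g U G) : ContDiffOn ℝ ∞ (cubic G) U :=
  Complex.imCLM.contDiff.comp_contDiffOn (contDiffOn_herm
    (contDiffOn_iterate_partialT h.isOpen h.smooth 3) (contDiffOn_iterate_partialT h.isOpen h.smooth 2))

theorem cubicOf_eq (h : IsJointLift J Γ₀ g U G) {t s : ℝ} (hts : (t, s) ∈ U) :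
    cubicOf (fun t => G (t, s)) t = cubic G (t, s) := by
  rw [cubicOf, iteratedDeriv_slice h.isOpen h.smooth 3 s hts,
    iteratedDeriv_slice h.isOpen h.smooth 2 s hts, cubic]

theorem hasDerivAt_jet (h : IsJointLift J Γ₀ g U G) (k : ℕ) {t : ℝ} (ht : t ∈ J) :
    HasDerivAt (fun s => iteratedDeriv k (fun t => G (t, s)) t)
      (iteratedDeriv k (fun t => partialS G (t, 0)) t) 0 := by
  have hm := h.mem_zero ht
  have hd := hasDerivAt_partialS h.isOpen (contDiffOn_iterate_partialT h.isOpen h.smooth k) hm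
  rw [partialS_iterate_partialT h.isOpen h.smooth k hm] at hd
  rw [iteratedDeriv_slice h.isOpen (contDiffOn_partialS h.isOpen h.smooth) k 0 hm]
  have ho : IsOpen {s : ℝ | (t, s) ∈ U} := h.isOpen.preimage (by fun_prop)
  refine hd.congr_of_eventuallyEq ?_
  filter_upwards [ho.mem_nhds hm] with s hs
  exact iteratedDeriv_slice h.isOpen h.smooth k s hs

/-- The first variation of the cubic density. -/
theorem partialS_cubic (h : IsJointLift J Γ₀ g U G) (hJ : IsOpen J) {t : ℝ} (ht : t ∈ J) :
    partialS (cubic G) (t, 0) =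
      drift Γ₀ g t * iteratedDeriv 1 (cubicOf Γ₀) t + 3 * iteratedDeriv 1 (drift Γ₀ g) t * cubicOf Γ₀ t
        + 1 / 6 * fifthOrder (quadraticOf Γ₀) (hamiltonian Γ₀ g) t := by
  have ho : ∀ t, IsOpen {s : ℝ | (t, s) ∈ U} := fun t => h.isOpen.preimage (by fun_prop)
  have lin : ∀ (k l : ℕ) (c : ℂ), (∀ s, ∀ t ∈ slice U s,
      herm (iteratedDeriv k (fun t => G (t, s)) t) (iteratedDeriv l (fun t => G (t, s)) t) = c) →
      ∀ t ∈ J, herm (iteratedDeriv k (fun t => partialS G (t, 0)) t)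
        (iteratedDeriv l (fun t => G (t, 0)) t) + herm (iteratedDeriv k (fun t => G (t, 0)) t)
        (iteratedDeriv l (fun t => partialS G (t, 0)) t) = 0 := fun k l c hc t ht =>
    herm_deriv_of_const (ho t) (fun s hs => hc s t hs) (h.mem_zero ht) (h.hasDerivAt_jet k ht)
      (h.hasDerivAt_jet l ht)
  have L00 := lin 0 0 0 (fun s t ht => by
    simpa using (h.normalized s).herm_self (h.legendrian s) ht)
  have L01 := lin 0 1 0 (fun s t ht => by
    simpa using (h.normalized s).herm_zero_one (isOpen_slice h.isOpen s) (h.legendrian s) ht)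
  have L11 := lin 1 1 1 (fun s t ht =>
    (h.normalized s).herm_one_one (isOpen_slice h.isOpen s) (h.legendrian s) ht)
  have L12 := lin 1 2 0 (fun s t ht =>
    (h.normalized s).herm_one_two (isOpen_slice h.isOpen s) (h.legendrian s) ht)
  simp only [iteratedDeriv_zero] at L00 L01
  have key := cubic_linearization hJ h.legendrian_zero h.normalized_zero h.contDiffOn_field
    L00 L01 L11 L12 ht
  have hd : HasDerivAt (fun s => cubic G (t, s)) _ 0 :=
    (Complex.imCLM.hasFDerivAt.comp_hasDerivAt 0
      (hasDerivAt_herm (h.hasDerivAt_jet 3 ht) (h.hasDerivAt_jet 2 ht))).congr_of_eventuallyEq (by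
        filter_upwards [(ho t).mem_nhds (h.mem_zero ht)] with s hs
        exact (h.cubicOf_eq hs).symm)
  have e := (hasDerivAt_partialS h.isOpen h.contDiffOn_cubic (h.mem_zero ht)).unique hd
  rw [e]
  refine Eq.trans key ?_
  have hΓ : ∀ k, Set.EqOn (iteratedDeriv k (fun t => G (t, 0))) (iteratedDeriv k Γ₀) J :=
    h.iteratedDeriv_initial hJ
  have ec : Set.EqOn (cubicOf (fun t => G (t, 0))) (cubicOf Γ₀) J := fun s hs => by
    rw [cubicOf, hΓ 3 hs, hΓ 2 hs, cubicOf]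
  have eq : Set.EqOn (quadraticOf (fun t => G (t, 0))) (quadraticOf Γ₀) J := fun s hs => by
    rw [quadraticOf, hΓ 2 hs, quadraticOf]
  have ed : Set.EqOn (drift Γ₀ g)
      (tangentPart (fun t => G (t, 0)) (fun t => partialS G (t, 0))) J :=
    fun s hs => h.drift_eq hJ hs
  have eh : Set.EqOn (hamiltonian Γ₀ g)
      (contactPart (fun t => G (t, 0)) (fun t => partialS G (t, 0))) J :=
    fun s hs => h.hamiltonian_eq hs
  simp only [fifthOrder]
  rw [ed ht, eh ht, ← ec ht, ← eq ht]
  simp only [iteratedDeriv_eqOn hJ ed _ ht, iteratedDeriv_eqOn hJ eh _ ht,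
    iteratedDeriv_eqOn hJ ec _ ht, iteratedDeriv_eqOn hJ eq _ ht]

theorem contDiffOn_hamiltonian (h : IsJointLift J Γ₀ g U G) :
    ContDiffOn ℝ ∞ (hamiltonian Γ₀ g) J :=
  (contDiffOn_contactPart h.normalized_zero.smooth h.contDiffOn_field).congr
    fun _ ht => h.hamiltonian_eq ht

theorem contDiffOn_drift (h : IsJointLift J Γ₀ g U G) (hJ : IsOpen J) :
    ContDiffOn ℝ ∞ (drift Γ₀ g) J :=
  (contDiffOn_tangentPart hJ h.normalized_zero.smooth h.contDiffOn_field).congr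
    fun _ ht => h.drift_eq hJ ht

end IsJointLift
end JointLift

/-! ### The first variation formula -/

section Integral

open MeasureTheory

/-- Differentiation under the integral over a compact set, for an integrand smooth only on a
neighbourhood of that set. -/
theorem hasDerivAt_setIntegral {O : Set (ℝ × ℝ)} {F : ℝ × ℝ → ℝ} (hO : IsOpen O)
    (hF : ContDiffOn ℝ ∞ F O) {K : Set ℝ} (hK : IsCompact K) (hKO : ∀ t ∈ K, (t, (0 : ℝ)) ∈ O) :
    HasDerivAt (fun s => ∫ t in K, F (t, s)) (∫ t in K, partialS F (t, 0)) 0 := by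
  obtain ⟨u, v, -, hv, hKu, h0v, huv⟩ := generalized_tube_lemma hK
    (isCompact_singleton (x := (0 : ℝ))) hO (fun x hx => by
      obtain ⟨h1, h2⟩ := hx
      rw [Set.mem_singleton_iff] at h2
      rw [← Prod.mk.eta (p := x), h2]
      exact hKO _ h1)
  obtain ⟨δ, hδ, hδv⟩ := Metric.nhds_basis_closedBall.mem_iff.1 (hv.mem_nhds (h0v rfl))
  have hin : ∀ t ∈ K, ∀ s ∈ Metric.closedBall (0 : ℝ) δ, (t, s) ∈ O :=
    fun t ht s hs => huv ⟨hKu ht, hδv hs⟩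
  have hcp : IsCompact (K ×ˢ Metric.closedBall (0 : ℝ) δ) := hK.prod (isCompact_closedBall 0 δ)
  have hd := contDiffOn_partialS hO hF
  obtain ⟨C, hC⟩ := hcp.exists_bound_of_continuousOn
    (hd.continuousOn.mono fun x hx => hin _ hx.1 _ hx.2)
  have hcont : ∀ {H : ℝ × ℝ → ℝ}, ContDiffOn ℝ ∞ H O → ∀ s ∈ Metric.closedBall (0 : ℝ) δ,
      ContinuousOn (fun t => H (t, s)) K := fun hH s hs =>
    hH.continuousOn.comp (by fun_prop) (fun t ht => hin t ht s hs)
  have hnh := Metric.closedBall_mem_nhds (0 : ℝ) hδ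
  refine (hasDerivAt_integral_of_dominated_loc_of_deriv_le (bound := fun _ => C)
    (F := fun s t => F (t, s)) (F' := fun s t => partialS F (t, s)) hnh ?_ ?_ ?_ ?_ ?_ ?_).2
  · filter_upwards [hnh] with s hs
    exact (hcont hF s hs).aestronglyMeasurable hK.measurableSet
  · exact (hcont hF 0 (mem_of_mem_nhds hnh)).integrableOn_compact hK
  · exact (hcont hd 0 (mem_of_mem_nhds hnh)).aestronglyMeasurable hK.measurableSet
  · filter_upwards [ae_restrict_mem hK.measurableSet] with t ht s hs
    exact hC (t, s) ⟨ht, hs⟩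
  · have : IsFiniteMeasure (volume.restrict K) := ⟨by
      rw [Measure.restrict_apply_univ]; exact hK.measure_lt_top⟩
    exact integrable_const C
  · filter_upwards [ae_restrict_mem hK.measurableSet] with t ht s hs
    exact hasDerivAt_partialS hO hF (hin t ht s hs)

theorem contDiffOn_fifthOrder {J : Set ℝ} (hJ : IsOpen J) {b φ : ℝ → ℝ}
    (hb : ContDiffOn ℝ ∞ b J) (hφ : ContDiffOn ℝ ∞ φ J) :
    ContDiffOn ℝ ∞ (fifthOrder b φ) J := by
  have bk := contDiffOn_iteratedDeriv hJ hb
  have φk := contDiffOn_iteratedDeriv hJ hφ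
  exact ((((φk 5).add ((contDiffOn_const.mul hb).mul (φk 3))).add
    ((contDiffOn_const.mul (bk 1)).mul (φk 2))).add
    (((contDiffOn_const.mul (bk 2)).add (contDiffOn_const.mul (hb.pow 2))).mul (φk 1))).add
    (((contDiffOn_const.mul (bk 3)).add ((contDiffOn_const.mul hb).mul (bk 1))).mul hφ)

theorem abs_rpow_third (x : ℝ) : |x| ^ (1 / 3 : ℝ) = (x ^ 2) ^ (1 / 6 : ℝ) := by
  rw [← sq_abs, ← Real.rpow_natCast, ← Real.rpow_mul (abs_nonneg x)]
  norm_num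

variable {J : Set ℝ} {Γ₀ : ℝ → C3} {g : ℝ → ℝ → C2} {U : Set (ℝ × ℝ)} {G : ℝ × ℝ → C3}

/-- The variation field vanishes on the open set `J \ K`, where `K` is the support. -/
theorem variation_zero_off_support (hJ : IsOpen J) (hK : IsCompact (variationSupport J g)) :
    IsOpen (J \ variationSupport J g) ∧
      ∀ t ∈ J \ variationSupport J g, variationField g t = 0 := by
  refine ⟨hJ.sdiff hK.isClosed, fun t ht => ?_⟩
  by_contra hne
  exact ht.2 ⟨ht.1, subset_closure ⟨ht.1, hne⟩⟩

/-- First variation formula: if the cubic density has no zero on an interval `[α, β]` around the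
support of the variation, the total strain is differentiable along the variation and its
derivative is `-(1/18) ∫ h D u`, where `h` is the contact Hamiltonian and `u` the multiplier. -/
theorem IsJointLift.hasDerivAt_strainFunctional (h : IsJointLift J Γ₀ g U G) (hJ : IsOpen J)
    (hJc : J.OrdConnected) {ε : ℝ} (hε : 0 < ε)
    (hleg : ∀ s ∈ Set.Ioo (-ε) ε, IsLegendrian J (fun t => g t s))
    (hK : IsCompact (variationSupport J g)) {α β : ℝ} (hαβ : α ≤ β) (hJαβ : Set.Icc α β ⊆ J)
    (hKαβ : variationSupport J g ⊆ Set.Ioo α β) (ha0 : ∀ t ∈ Set.Icc α β, cubicOf Γ₀ t ≠ 0) :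
    HasDerivAt (strainFunctional J g)
      (-(1 / 18) * ∫ t in α..β, hamiltonian Γ₀ g t *
        fifthOrder (quadraticOf Γ₀) (multiplier (cubicOf Γ₀)) t) 0 := by
  set K := variationSupport J g with hKdef
  set O : Set (ℝ × ℝ) := U ∩ (IsJointLift.cubic G) ⁻¹' {x | x ≠ 0} with hOdef
  have hOo : IsOpen O := h.contDiffOn_cubic.continuousOn.isOpen_inter_preimage h.isOpen isOpen_ne
  have hcub : ContDiffOn ℝ ∞ (IsJointLift.cubic G) O := h.contDiffOn_cubic.mono Set.inter_subset_left
  set F : ℝ × ℝ → ℝ := fun x => (IsJointLift.cubic G x ^ 2) ^ (1 / 6 : ℝ) with hFdef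
  have hF : ContDiffOn ℝ ∞ F O :=
    (hcub.pow 2).rpow_const_of_ne fun x hx => pow_ne_zero 2 hx.2
  have hKI : K ⊆ Set.Icc α β := hKαβ.trans Set.Ioo_subset_Icc_self
  have hc0 : ∀ t ∈ J, IsJointLift.cubic G (t, 0) = cubicOf Γ₀ t := fun t ht => by
    rw [← h.cubicOf_eq (h.mem_zero ht), cubicOf, h.iteratedDeriv_initial hJ 3 ht,
      h.iteratedDeriv_initial hJ 2 ht, cubicOf]
  have hIcc : ∀ t ∈ Set.Icc α β, (t, (0 : ℝ)) ∈ O := fun t ht =>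
    ⟨h.mem_zero (hJαβ ht), by
      simp only [Set.mem_preimage, hc0 t (hJαβ ht)]
      exact ha0 t ht⟩
  have hder := hasDerivAt_setIntegral hOo hF hK (fun t ht => hIcc t (hKI ht))
  -- Near the initial curve the functional is the integral of the smooth function `F`.
  have hev : strainFunctional J g =ᶠ[nhds 0] fun s => ∫ t in K, F (t, s) := by
    obtain ⟨u, v, -, hv, hKu, h0v, huv⟩ := generalized_tube_lemma hK
      (isCompact_singleton (x := (0 : ℝ))) h.isOpen (fun x hx => by
        obtain ⟨h1, h2⟩ := hx
        rw [Set.mem_singleton_iff] at h2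
        rw [← Prod.mk.eta (p := x), h2]
        exact h.mem_zero (hJαβ (hKI h1)))
    filter_upwards [hv.mem_nhds (h0v rfl), Ioo_mem_nhds (neg_lt_zero.2 hε) hε] with s hs hsε
    refine setIntegral_congr_fun hK.measurableSet fun t ht => ?_
    have hts : (t, s) ∈ U := huv ⟨hKu ht, hs⟩
    have hUJ : slice U s ⊆ J := fun t' ht' => h.fst_mem _ ht'
    have := cubicDensity_eq hJ hJc (hleg s hsε) (isOpen_slice h.isOpen s) hUJ (h.normalized s) hts
    simp only [strainDensity, hFdef]
    rw [this, h.cubicOf_eq hts, abs_rpow_third]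
  refine (hder.congr_of_eventuallyEq hev).congr_deriv ?_
  set a := cubicOf Γ₀ with hadef
  set b := quadraticOf Γ₀ with hbdef
  set φ := hamiltonian Γ₀ g with hφdef
  set f := drift Γ₀ g with hfdef
  set u := multiplier a with hudef
  have has : ContDiffOn ℝ ∞ a J := (h.normalized_zero.contDiffOn_cubicOf hJ).congr fun t ht => by
    rw [← hc0 t ht, h.cubicOf_eq (h.mem_zero ht)]
  have hbs : ContDiffOn ℝ ∞ b J := (h.normalized_zero.contDiffOn_quadraticOf hJ).congr fun t ht => by
    rw [quadraticOf, h.iteratedDeriv_initial hJ 2 ht, hbdef, quadraticOf]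
  have hφs : ContDiffOn ℝ ∞ φ J := h.contDiffOn_hamiltonian
  have hfs : ContDiffOn ℝ ∞ f J := h.contDiffOn_drift hJ
  set N : Set ℝ := {t | t ∈ J ∧ a t ≠ 0} with hN
  have hNo : IsOpen N := has.continuousOn.isOpen_inter_preimage hJ isOpen_ne
  have hNJ : N ⊆ J := fun t ht => ht.1
  have hIN : Set.Icc α β ⊆ N := fun t ht => ⟨hJαβ ht, ha0 t ht⟩
  have hus : ContDiffOn ℝ ∞ u N := contDiffOn_multiplier (has.mono hNJ) fun t ht => ht.2
  obtain ⟨hoff, hvoff⟩ := variation_zero_off_support hJ hK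
  have hφ0 : ∀ k, ∀ t ∈ J \ K, iteratedDeriv k φ t = 0 := fun k t ht => by
    have : Set.EqOn φ (fun _ => 0) (J \ K) := fun s hs => by
      simp [hφdef, hamiltonian, hvoff s hs, homogLin, herm]
    rw [iteratedDeriv_eqOn hoff this k ht]
    simp
  have hf0 : ∀ k, ∀ t ∈ J \ K, iteratedDeriv k f t = 0 := fun k t ht => by
    have : Set.EqOn f (fun _ => 0) (J \ K) := fun s hs => by
      simp [hfdef, drift, hvoff s hs, homogLin, herm]
    rw [iteratedDeriv_eqOn hoff this k ht]
    simp
  have hφ00 : ∀ t ∈ J \ K, φ t = 0 := fun t ht => by simpa using hφ0 0 t ht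
  have hf00 : ∀ t ∈ J \ K, f t = 0 := fun t ht => by simpa using hf0 0 t ht
  set Φ : ℝ → ℝ := fun t => 1 / 3 * u t * (f t * iteratedDeriv 1 a t
    + 3 * iteratedDeriv 1 f t * a t + 1 / 6 * fifthOrder b φ t) with hΦ
  have hpS : ∀ t ∈ Set.Icc α β, partialS F (t, 0) = Φ t := fun t ht => by
    have hd := hasDerivAt_partialS h.isOpen h.contDiffOn_cubic (h.mem_zero (hJαβ ht))
    have hne : IsJointLift.cubic G (t, 0) ≠ 0 := (hIcc t ht).2
    have hp := (hd.fun_pow 2).rpow_const (p := (1 / 6 : ℝ)) (Or.inl (pow_ne_zero 2 hne))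
    rw [(hasDerivAt_partialS hOo hF (hIcc t ht)).unique hp, h.partialS_cubic hJ (hJαβ ht),
      hc0 t (hJαβ ht)]
    simp only [hΦ, hudef, multiplier]
    norm_num
    ring
  have hK1 : ∫ t in K, partialS F (t, 0) = ∫ t in K, Φ t :=
    setIntegral_congr_fun hK.measurableSet fun t ht => hpS t (hKI ht)
  have hK2 : ∫ t in K, Φ t = ∫ t in α..β, Φ t := by
    rw [intervalIntegral.integral_of_le hαβ]
    refine (setIntegral_eq_of_subset_of_forall_sdiff_eq_zero measurableSet_Ioc
      (hKαβ.trans Set.Ioo_subset_Ioc_self) fun t ht => ?_).symm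
    have htJ : t ∈ J \ K := ⟨hJαβ ⟨ht.1.1.le, ht.1.2⟩, ht.2⟩
    simp only [hΦ, fifthOrder, hφ0 _ t htJ, hf0 _ t htJ, hφ00 t htJ, hf00 t htJ]
    ring
  -- The integrand is an exact derivative up to `-(1/18) φ D u`.
  set Θ : ℝ → ℝ := fun t => f t * (u t * a t) + 1 / 18 * concomitant b u φ t with hΘ
  have hΘd : ∀ t ∈ Set.Icc α β, HasDerivAt Θ (Φ t + 1 / 18 * (φ t * fifthOrder b u t)) t :=
    fun t ht => by
      have hne := ha0 t ht
      have da := hasDerivAt_of_contDiffOn hJ has (hJαβ ht)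
      have df := hasDerivAt_of_contDiffOn hJ hfs (hJαβ ht)
      refine ((df.fun_mul ((hasDerivAt_multiplier da hne).fun_mul da)).fun_add
        ((hasDerivAt_concomitant hNo (hbs.mono hNJ) hus (hφs.mono hNJ) (hIN ht)).const_mul
          (1 / 18))).congr_deriv ?_
      simp only [hΦ, ← hudef]
      field_simp
      ring
  have hcontD : ContinuousOn (fun t => φ t * fifthOrder b u t) (Set.Icc α β) :=
    (hφs.continuousOn.mono hJαβ).mul
      ((contDiffOn_fifthOrder hNo (hbs.mono hNJ) hus).continuousOn.mono hIN)
  have hcontΦ : ContinuousOn Φ (Set.Icc α β) :=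
    (((contDiffOn_partialS hOo hF).continuousOn.comp (f := fun t : ℝ => (t, (0 : ℝ)))
      (by fun_prop) (fun t ht => hIcc t ht))).congr fun t ht => (hpS t ht).symm
  have hint1 : IntervalIntegrable Φ volume α β :=
    (hcontΦ.mono (by rw [Set.uIcc_of_le hαβ])).intervalIntegrable
  have hint2 : IntervalIntegrable (fun t => φ t * fifthOrder b u t) volume α β :=
    (hcontD.mono (by rw [Set.uIcc_of_le hαβ])).intervalIntegrable
  have hFTC := intervalIntegral.integral_eq_sub_of_hasDerivAt
    (fun t ht => hΘd t (by rwa [Set.uIcc_of_le hαβ] at ht)) (hint1.add (hint2.const_mul (1 / 18)))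
  have hend : ∀ t ∈ J \ K, Θ t = 0 := fun t ht => by
    simp only [hΘ, concomitant, hφ0 _ t ht, hφ00 t ht, hf00 t ht]
    ring
  rw [hend α ⟨hJαβ ⟨le_rfl, hαβ⟩, fun hα => (hKαβ hα).1.false⟩,
    hend β ⟨hJαβ ⟨hαβ, le_rfl⟩, fun hβ => (hKαβ hβ).2.false⟩,
    intervalIntegral.integral_add hint1 (hint2.const_mul _),
    intervalIntegral.integral_const_mul] at hFTC
  rw [hK1, hK2]
  linarith

end Integral

/-! ### Legendrian curves in Heisenberg coordinates -/

section Heisenberg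

/-- The second Heisenberg coordinate `r + i (x² + y²)/2` of a point of the hyperquadric. -/
noncomputable def heisEta (x y r : ℝ) : ℂ := (r : ℂ) + Complex.I * (((x ^ 2 + y ^ 2) / 2 : ℝ) : ℂ)

/-- Homogeneous coordinates of the point of the hyperquadric with Heisenberg coordinates
`c̄ (x + i y)` and `r`; the unit `c` rotates the first one. -/
noncomputable def heisVec (c : ℂ) (x y r : ℝ) : C3 :=
  ![1, starRingEnd ℂ c * (x + Complex.I * y), heisEta x y r]

/-- The point of the sphere with Heisenberg coordinates `c̄ (x + i y)` and `r`. -/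
noncomputable def heisPoint (c : ℂ) (x y r : ℝ) : C2 :=
  WithLp.toLp 2 ![(1 + Complex.I * heisEta x y r) * (1 - Complex.I * heisEta x y r)⁻¹,
    -(Complex.I * (Real.sqrt 2 : ℂ) * (starRingEnd ℂ c * (x + Complex.I * y)))
      * (1 - Complex.I * heisEta x y r)⁻¹]

/-- The factor between `homog` of a point of the sphere and its Heisenberg vector. -/
noncomputable def heisFactor (x y r : ℝ) : ℂ := (1 - Complex.I * heisEta x y r)⁻¹

theorem one_sub_heisEta_ne_zero (x y r : ℝ) : 1 - Complex.I * heisEta x y r ≠ 0 := by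
  intro h
  have := congrArg Complex.re h
  simp only [heisEta, Complex.sub_re, Complex.mul_re, Complex.add_re, Complex.add_im,
    Complex.mul_im, Complex.ofReal_re, Complex.ofReal_im, Complex.I_re, Complex.I_im,
    Complex.one_re, Complex.zero_re] at this
  nlinarith [sq_nonneg x, sq_nonneg y]

theorem homog_heisPoint (c : ℂ) (x y r : ℝ) :
    homog (heisPoint c x y r) = heisFactor x y r • heisVec c x y r := by
  have h1 := one_sub_heisEta_ne_zero x y r
  have h2 : (Real.sqrt 2 : ℂ) ≠ 0 := by simp
  ext i
  fin_cases i
  · simp [homog, heisPoint, heisFactor, heisVec]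
    field_simp
    ring
  · simp [homog, heisPoint, heisFactor, heisVec]
    field_simp
    rw [Complex.I_sq]
    ring
  · simp [homog, heisPoint, heisFactor, heisVec]
    field_simp
    linear_combination (-2 * heisEta x y r) * Complex.I_sq

theorem herm_heisVec {c : ℂ} (hc : starRingEnd ℂ c * c = 1) (x y r : ℝ) :
    herm (heisVec c x y r) (heisVec c x y r) = 0 := by
  simp only [herm, heisVec, heisEta]
  have h2 : starRingEnd ℂ 2 = 2 := map_ofNat _ 2
  simp [h2]
  linear_combination ((x : ℂ) ^ 2 + y ^ 2) * hc + ((x : ℂ) ^ 2 + y ^ 2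
    - y ^ 2 * c * starRingEnd ℂ c) * Complex.I_sq

/-- The velocity of the Heisenberg vector of a curve with velocity `(x', y', r')`. -/
noncomputable def heisVel (c : ℂ) (x y x' y' r' : ℝ) : C3 :=
  ![0, starRingEnd ℂ c * (x' + Complex.I * y'),
    (r' : ℂ) + Complex.I * ((x * x' + y * y' : ℝ) : ℂ)]

theorem herm_heisVel {c : ℂ} (hc : starRingEnd ℂ c * c = 1) (x y r x' y' r' : ℝ) :
    herm (heisVec c x y r) (heisVel c x y x' y' r') =
      Complex.I * ((r' + x * y' - y * x' : ℝ) : ℂ) := by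
  simp only [herm, heisVec, heisVel, heisEta]
  simp
  linear_combination ((x : ℂ) - Complex.I * y) * (x' + Complex.I * y') * hc
    + ((x : ℂ) * x') * Complex.I_sq

theorem hasDerivAt_heisVec (c : ℂ) {x y r : ℝ → ℝ} {x' y' r' t : ℝ} (hx : HasDerivAt x x' t)
    (hy : HasDerivAt y y' t) (hr : HasDerivAt r r' t) :
    HasDerivAt (fun s => heisVec c (x s) (y s) (r s)) (heisVel c (x t) (y t) x' y' r') t := by
  rw [hasDerivAt_pi]
  intro i
  fin_cases i
  · exact hasDerivAt_const t (1 : ℂ)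
  · exact (hx.ofReal_comp.fun_add (hy.ofReal_comp.const_mul Complex.I)).const_mul (starRingEnd ℂ c)
  · have h := (((hx.fun_pow 2).fun_add (hy.fun_pow 2)).div_const 2).ofReal_comp
    refine (hr.ofReal_comp.fun_add (h.const_mul Complex.I)).congr_deriv ?_
    simp [heisVel]
    ring

variable {E : Type*} [NormedAddCommGroup E] [NormedSpace ℝ E] {S : Set E} {x y r : E → ℝ}

theorem contDiffOn_heisEta (hx : ContDiffOn ℝ ∞ x S) (hy : ContDiffOn ℝ ∞ y S)
    (hr : ContDiffOn ℝ ∞ r S) : ContDiffOn ℝ ∞ (fun p => heisEta (x p) (y p) (r p)) S :=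
  (Complex.ofRealCLM.contDiff.comp_contDiffOn hr).add (contDiffOn_const.mul
    (Complex.ofRealCLM.contDiff.comp_contDiffOn (((hx.pow 2).add (hy.pow 2)).div_const 2)))

theorem contDiffOn_heisFactor (hx : ContDiffOn ℝ ∞ x S) (hy : ContDiffOn ℝ ∞ y S)
    (hr : ContDiffOn ℝ ∞ r S) : ContDiffOn ℝ ∞ (fun p => heisFactor (x p) (y p) (r p)) S :=
  (contDiffOn_const.sub (contDiffOn_const.mul (contDiffOn_heisEta hx hy hr))).inv
    fun p _ => one_sub_heisEta_ne_zero (x p) (y p) (r p)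

theorem contDiffOn_heisPoint (c : ℂ) (hx : ContDiffOn ℝ ∞ x S) (hy : ContDiffOn ℝ ∞ y S)
    (hr : ContDiffOn ℝ ∞ r S) : ContDiffOn ℝ ∞ (fun p => heisPoint c (x p) (y p) (r p)) S := by
  have hf := contDiffOn_heisFactor hx hy hr
  have he := contDiffOn_heisEta hx hy hr
  have hz : ContDiffOn ℝ ∞ (fun p => starRingEnd ℂ c * ((x p : ℂ) + Complex.I * (y p : ℂ))) S :=
    contDiffOn_const.mul ((Complex.ofRealCLM.contDiff.comp_contDiffOn hx).add
      (contDiffOn_const.mul (Complex.ofRealCLM.contDiff.comp_contDiffOn hy)))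
  rw [contDiffOn_piLp]
  intro i
  fin_cases i
  · exact (contDiffOn_const.add (contDiffOn_const.mul he)).mul hf
  · exact (contDiffOn_const.mul hz).neg.mul hf

/-- A curve in Heisenberg coordinates with `x' ≠ 0` is Legendrian when `r' + x y' - y x' = 0`. -/
theorem isLegendrian_heisPoint {c : ℂ} (hc : starRingEnd ℂ c * c = 1) {N : Set ℝ} (hN : IsOpen N)
    {x y r : ℝ → ℝ} (hx : ContDiffOn ℝ ∞ x N) (hy : ContDiffOn ℝ ∞ y N) (hr : ContDiffOn ℝ ∞ r N)
    (hx0 : ∀ t ∈ N, deriv x t ≠ 0)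
    (hcon : ∀ t ∈ N, deriv r t + x t * deriv y t - y t * deriv x t = 0) :
    IsLegendrian N (fun t => heisPoint c (x t) (y t) (r t)) := by
  have hs := contDiffOn_heisPoint c hx hy hr
  have hd : ∀ {F : ℝ → ℝ}, ContDiffOn ℝ ∞ F N → ∀ t ∈ N, HasDerivAt F (deriv F t) t :=
    fun hF t ht => ((hF.differentiableOn (by simp)).differentiableAt (hN.mem_nhds ht)).hasDerivAt
  have hm : ∀ t ∈ N, HasDerivAt (fun t => heisFactor (x t) (y t) (r t))
      (deriv (fun t => heisFactor (x t) (y t) (r t)) t) t := fun t ht =>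
    (((contDiffOn_heisFactor hx hy hr).differentiableOn (by simp)).differentiableAt
      (hN.mem_nhds ht)).hasDerivAt
  have hh : ∀ t ∈ N, HasDerivAt (fun u => homog (heisPoint c (x u) (y u) (r u))) _ t :=
    fun t ht => by
      simp only [homog_heisPoint]
      exact (hm t ht).smul (hasDerivAt_heisVec c (hd hx t ht) (hd hy t ht) (hd hr t ht))
  refine ⟨hs, fun t ht => ?_, fun t ht h0 => ?_, fun t ht => ?_⟩
  · have h1 := herm_homog (heisPoint c (x t) (y t) (r t))
    rw [homog_heisPoint, herm_smul_left, herm_smul_right, herm_heisVec hc, mul_zero, mul_zero] at h1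
    have h2 : ‖heisPoint c (x t) (y t) (r t)‖ ^ 2 - 1 = 0 := by
      have h3 : ((‖heisPoint c (x t) (y t) (r t)‖ ^ 2 - 1 : ℝ) : ℂ) = 0 := by
        linear_combination -2 * h1
      exact_mod_cast h3
    exact (pow_eq_one_iff_of_nonneg (norm_nonneg _) two_ne_zero).1 (by linarith)
  · have hγ := (hs.differentiableOn (by simp)).differentiableAt (hN.mem_nhds ht)
    have e := (hh t ht).unique (hasDerivAt_homog hγ.hasDerivAt)
    rw [h0] at e
    have e0 := congrFun e 0
    have e1 := congrFun e 1
    simp [homogLin, heisVec, heisVel] at e0 e1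
    rw [e0] at e1
    have hne : heisFactor (x t) (y t) (r t) ≠ 0 := inv_ne_zero (one_sub_heisEta_ne_zero _ _ _)
    have hcne : c ≠ 0 := fun h => by simp [h] at hc
    simp [hne, hcne] at e1
    have := congrArg Complex.re e1
    simp at this
    exact hx0 t ht this
  · rw [(hh t ht).deriv, homog_heisPoint]
    simp only [herm_add_right, herm_smul_right, herm_smul_left, herm_heisVec hc, herm_heisVel hc,
      hcon t ht]
    simp

end Heisenberg

section Locality

variable {N M : Set ℝ} {γ σ : ℝ → C2}

theorem IsLegendrian.congr (hN : IsOpen N) (h : IsLegendrian N γ) (he : Set.EqOn σ γ N) :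
    IsLegendrian N σ := by
  have hev : ∀ t ∈ N, σ =ᶠ[nhds t] γ := fun t ht => he.eventuallyEq_of_mem (hN.mem_nhds ht)
  refine ⟨h.smooth.congr he, fun t ht => he ht ▸ h.mem_sphere t ht, fun t ht => ?_, fun t ht => ?_⟩
  · rw [(hev t ht).deriv_eq]; exact h.immersion t ht
  · have : (fun u => homog (σ u)) =ᶠ[nhds t] fun u => homog (γ u) := (hev t ht).fun_comp homog
    rw [this.deriv_eq, he ht]
    exact h.contact t ht

theorem IsLegendrian.union (hN : IsOpen N) (hM : IsOpen M) (h : IsLegendrian N γ)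
    (h' : IsLegendrian M γ) : IsLegendrian (N ∪ M) γ :=
  ⟨h.smooth.union_of_isOpen h'.smooth hN hM,
    fun t ht => ht.elim (h.mem_sphere t) (h'.mem_sphere t),
    fun t ht => ht.elim (h.immersion t) (h'.immersion t),
    fun t ht => ht.elim (h.contact t) (h'.contact t)⟩

end Locality

/-! ### Construction of variations -/

section Coordinates

/-- The Heisenberg coordinate `c ζ` of a curve, with `ζ = Z¹/Z⁰` in homogeneous coordinates. -/
noncomputable def heisZeta (c : ℂ) (γ : ℝ → C2) (t : ℝ) : ℂ :=
  c * (homogCurve γ t 1 / homogCurve γ t 0)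

/-- The real part of the second affine coordinate `Z²/Z⁰` of a curve. -/
noncomputable def heisHeight (γ : ℝ → C2) (t : ℝ) : ℝ :=
  (homogCurve γ t 2 / homogCurve γ t 0).re

variable {J : Set ℝ} {γ : ℝ → C2}

/-- Off the pole, the homogeneous coordinates of a point of the sphere are a multiple of its
Heisenberg vector. -/
theorem homogCurve_eq_heisVec {c : ℂ} (hc : starRingEnd ℂ c * c = 1) {t : ℝ} (hγ : ‖γ t‖ = 1)
    (h0 : homogCurve γ t 0 ≠ 0) :
    homogCurve γ t = homogCurve γ t 0 •
      heisVec c (heisZeta c γ t).re (heisZeta c γ t).im (heisHeight γ t) := by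
  set Z := homogCurve γ t with hZ
  have hn : herm Z Z = 0 := by rw [hZ, homogCurve, herm_homog, hγ]; simp
  have hxy : starRingEnd ℂ c * (((heisZeta c γ t).re : ℂ) + Complex.I * ((heisZeta c γ t).im : ℂ))
      = Z 1 / Z 0 := by
    rw [mul_comm Complex.I, Complex.re_add_im, heisZeta, ← mul_assoc, hc, one_mul]
  have hsq : (heisZeta c γ t).re ^ 2 + (heisZeta c γ t).im ^ 2 = Complex.normSq (Z 1 / Z 0) := by
    have h1 : Complex.normSq c = 1 := by
      have := hc
      rw [mul_comm, Complex.mul_conj] at this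
      exact_mod_cast this
    rw [← hxy, Complex.normSq_mul, Complex.normSq_conj, h1, one_mul, mul_comm Complex.I,
      Complex.re_add_im, Complex.normSq_apply]
    ring
  have hw : herm ((Z 0)⁻¹ • Z) ((Z 0)⁻¹ • Z) = 0 := by
    rw [herm_smul_left, herm_smul_right, hn]; simp
  have him : (Z 2 / Z 0).im = ((heisZeta c γ t).re ^ 2 + (heisZeta c γ t).im ^ 2) / 2 := by
    rw [hsq]
    have := congrArg Complex.re hw
    simp only [herm, Pi.smul_apply, smul_eq_mul, inv_mul_cancel₀ h0, map_one, mul_one, one_mul] at this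
    rw [mul_comm _ (Z 1), mul_comm _ (Z 2), ← div_eq_mul_inv, ← div_eq_mul_inv,
      mul_comm _ (Z 1 / Z 0), Complex.mul_conj] at this
    generalize Z 1 / Z 0 = w at this ⊢
    generalize Z 2 / Z 0 = v at this ⊢
    simp at this
    linarith
  have heta : heisEta (heisZeta c γ t).re (heisZeta c γ t).im (heisHeight γ t) = Z 2 / Z 0 := by
    rw [heisEta, ← him, heisHeight, mul_comm Complex.I, Complex.re_add_im]
  ext i
  fin_cases i
  · simp [heisVec]
  · simp only [heisVec, hxy]
    simp
    field_simp
  · simp only [heisVec, heta]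
    simp
    field_simp

theorem eq_heisPoint {c : ℂ} (hc : starRingEnd ℂ c * c = 1) {t : ℝ} (hγ : ‖γ t‖ = 1)
    (h0 : homogCurve γ t 0 ≠ 0) :
    γ t = heisPoint c (heisZeta c γ t).re (heisZeta c γ t).im (heisHeight γ t) := by
  have h := homogCurve_eq_heisVec hc hγ h0
  have h1 : heisFactor (heisZeta c γ t).re (heisZeta c γ t).im (heisHeight γ t)
      = homogCurve γ t 0 := by
    have e := chartForm_homog (γ t)
    change chartForm (homogCurve γ t) = 1 at e
    rw [h] at e
    refine inv_eq_of_mul_eq_one_left ?_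
    simp [chartForm, heisVec] at e
    linear_combination e
  have h2 : homog (γ t) =
      homog (heisPoint c (heisZeta c γ t).re (heisZeta c γ t).im (heisHeight γ t)) := by
    rw [homog_heisPoint, h1]; exact h
  ext i
  fin_cases i
  · have := congrFun h2 0
    simp [homog] at this
    exact this
  · have := congrFun h2 1
    simp [homog] at this
    exact this

theorem isOpen_chart (hJ : IsOpen J) (hγ : IsLegendrian J γ) :
    IsOpen {t | t ∈ J ∧ homogCurve γ t 0 ≠ 0} :=
  ((contDiffOn_pi.1 hγ.contDiffOn_homogCurve 0).continuousOn).isOpen_inter_preimage hJ isOpen_ne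

theorem contDiffOn_heisZeta (hγ : IsLegendrian J γ) (c : ℂ) :
    ContDiffOn ℝ ∞ (heisZeta c γ) {t | t ∈ J ∧ homogCurve γ t 0 ≠ 0} := by
  have hZ := contDiffOn_pi.1 (hγ.contDiffOn_homogCurve.mono
    (show {t | t ∈ J ∧ homogCurve γ t 0 ≠ 0} ⊆ J from fun t ht => ht.1))
  exact contDiffOn_const.mul (contDiffOn_div (hZ 1) (hZ 0) fun t ht => ht.2)

theorem contDiffOn_heisHeight (hγ : IsLegendrian J γ) :
    ContDiffOn ℝ ∞ (heisHeight γ) {t | t ∈ J ∧ homogCurve γ t 0 ≠ 0} := by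
  have hZ := contDiffOn_pi.1 (hγ.contDiffOn_homogCurve.mono
    (show {t | t ∈ J ∧ homogCurve γ t 0 ≠ 0} ⊆ J from fun t ht => ht.1))
  exact Complex.reCLM.contDiff.comp_contDiffOn (contDiffOn_div (hZ 2) (hZ 0) fun t ht => ht.2)

/-- In Heisenberg coordinates the contact condition is `r' + x y' - y x' = 0`, and the projection
`(x, y)` of a Legendrian curve is an immersion. -/
theorem heisenberg_contact (hJ : IsOpen J) (hγ : IsLegendrian J γ) {c : ℂ}
    (hc : starRingEnd ℂ c * c = 1) {t : ℝ} (ht : t ∈ J) (h0 : homogCurve γ t 0 ≠ 0) :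
    deriv (heisHeight γ) t + (heisZeta c γ t).re * deriv (fun s => (heisZeta c γ s).im) t
      - (heisZeta c γ t).im * deriv (fun s => (heisZeta c γ s).re) t = 0 ∧
    (deriv (fun s => (heisZeta c γ s).re) t ≠ 0 ∨ deriv (fun s => (heisZeta c γ s).im) t ≠ 0) := by
  set N : Set ℝ := {t | t ∈ J ∧ homogCurve γ t 0 ≠ 0} with hN
  have hNo : IsOpen N := isOpen_chart hJ hγ
  have htN : t ∈ N := ⟨ht, h0⟩
  have hζ := contDiffOn_heisZeta hγ c
  have hd : ∀ {F : ℝ → ℝ}, ContDiffOn ℝ ∞ F N → HasDerivAt F (deriv F t) t :=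
    fun hF => ((hF.differentiableOn (by simp)).differentiableAt (hNo.mem_nhds htN)).hasDerivAt
  have hx := hd (Complex.reCLM.contDiff.comp_contDiffOn hζ)
  have hy := hd (Complex.imCLM.contDiff.comp_contDiffOn hζ)
  have hr := hd (contDiffOn_heisHeight hγ)
  have hW := hasDerivAt_heisVec c hx hy hr
  simp only [Function.comp_apply, Complex.reCLM_apply, Complex.imCLM_apply] at hW
  set x' := deriv (⇑Complex.reCLM ∘ heisZeta c γ) t with hx'
  set y' := deriv (⇑Complex.imCLM ∘ heisZeta c γ) t with hy'
  set r' := deriv (heisHeight γ) t with hr'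
  have hZd := hasDerivAt_of_contDiffOn hJ hγ.contDiffOn_homogCurve ht
  have hm := hasDerivAt_pi.1 hZd 0
  have heq : homogCurve γ =ᶠ[nhds t] fun s => homogCurve γ s 0 •
      heisVec c (heisZeta c γ s).re (heisZeta c γ s).im (heisHeight γ s) :=
    Set.EqOn.eventuallyEq_of_mem (s := N)
      (fun s hs => homogCurve_eq_heisVec hc (hγ.mem_sphere s hs.1) hs.2) (hNo.mem_nhds htN)
  have hZ' := hZd.unique ((hm.smul hW).congr_of_eventuallyEq heq)
  have hcon := hγ.herm_deriv ht
  have hne := hγ.herm_deriv_deriv_ne hJ ht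
  have hcontact : r' + (heisZeta c γ t).re * y' - (heisZeta c γ t).im * x' = 0 := by
    rw [hZ', homogCurve_eq_heisVec hc (hγ.mem_sphere t ht) h0] at hcon
    simp only [herm_add_right, herm_smul_right, herm_smul_left, herm_heisVec hc, herm_heisVel hc]
      at hcon
    simp only [mul_zero, add_zero, mul_eq_zero, map_eq_zero, h0, Complex.I_ne_zero, false_or,
      Complex.ofReal_eq_zero] at hcon
    rcases hcon with hcon | hcon
    · simp [heisVec, h0] at hcon
    · exact hcon
  refine ⟨hcontact, ?_⟩
  by_contra hcon2
  push Not at hcon2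
  obtain ⟨e1, e2⟩ := hcon2
  have e1' : x' = 0 := e1
  have e2' : y' = 0 := e2
  rw [e1', e2', mul_zero, mul_zero, add_zero, sub_zero] at hcontact
  apply hne
  have hv : heisVel c (heisZeta c γ t).re (heisZeta c γ t).im 0 0 0 = 0 := by
    ext i
    fin_cases i <;> simp [heisVel]
  rw [hZ', e1', e2', hcontact, hv, smul_zero, zero_add, herm_smul_left, herm_smul_right,
    herm_heisVec hc]
  simp

/-- Near a point off the pole `(-1, 0)`, a Legendrian curve has Heisenberg coordinates, rotated by a
unit `c`, whose first coordinate is a local parameter. -/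
theorem exists_heisenberg_coordinates (hJ : IsOpen J) (hγ : IsLegendrian J γ) {t₀ : ℝ}
    (ht₀ : t₀ ∈ J) (h0 : homogCurve γ t₀ 0 ≠ 0) :
    ∃ c : ℂ, starRingEnd ℂ c * c = 1 ∧ ∃ I : Set ℝ, IsOpen I ∧ t₀ ∈ I ∧ I ⊆ J ∧
      ∃ x y r : ℝ → ℝ, ContDiffOn ℝ ∞ x I ∧ ContDiffOn ℝ ∞ y I ∧ ContDiffOn ℝ ∞ r I ∧
        (∀ t ∈ I, deriv x t ≠ 0) ∧
        (∀ t ∈ I, deriv r t + x t * deriv y t - y t * deriv x t = 0) ∧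
        ∀ t ∈ I, γ t = heisPoint c (x t) (y t) (r t) := by
  have main : ∀ c : ℂ, starRingEnd ℂ c * c = 1 → deriv (fun s => (heisZeta c γ s).re) t₀ ≠ 0 →
      ∃ I : Set ℝ, IsOpen I ∧ t₀ ∈ I ∧ I ⊆ J ∧
      ∃ x y r : ℝ → ℝ, ContDiffOn ℝ ∞ x I ∧ ContDiffOn ℝ ∞ y I ∧ ContDiffOn ℝ ∞ r I ∧
        (∀ t ∈ I, deriv x t ≠ 0) ∧
        (∀ t ∈ I, deriv r t + x t * deriv y t - y t * deriv x t = 0) ∧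
        ∀ t ∈ I, γ t = heisPoint c (x t) (y t) (r t) := by
    intro c hc hx0
    have hN := isOpen_chart hJ hγ
    have hx : ContDiffOn ℝ ∞ (fun s => (heisZeta c γ s).re) {t | t ∈ J ∧ homogCurve γ t 0 ≠ 0} :=
      Complex.reCLM.contDiff.comp_contDiffOn (contDiffOn_heisZeta hγ c)
    have hy : ContDiffOn ℝ ∞ (fun s => (heisZeta c γ s).im) {t | t ∈ J ∧ homogCurve γ t 0 ≠ 0} :=
      Complex.imCLM.contDiff.comp_contDiffOn (contDiffOn_heisZeta hγ c)
    have hI := (contDiffOn_deriv hN hx).continuousOn.isOpen_inter_preimage hN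
      (isOpen_ne (x := (0 : ℝ)))
    refine ⟨_, hI, ⟨⟨ht₀, h0⟩, hx0⟩, fun t ht => ht.1.1, _, _, heisHeight γ,
      hx.mono Set.inter_subset_left, hy.mono Set.inter_subset_left,
      (contDiffOn_heisHeight hγ).mono Set.inter_subset_left, fun t ht => ht.2,
      fun t ht => (heisenberg_contact hJ hγ hc ht.1.1 ht.1.2).1,
      fun t ht => eq_heisPoint hc (hγ.mem_sphere t ht.1.1) ht.1.2⟩
  have h1 : starRingEnd ℂ (1 : ℂ) * 1 = 1 := by simp
  have hI : starRingEnd ℂ (-Complex.I) * -Complex.I = 1 := by simp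
  -- If `x` is not a local parameter, then `y` is, and multiplication by `-i` exchanges them.
  rcases (heisenberg_contact hJ hγ h1 ht₀ h0).2 with h | h
  · exact ⟨1, h1, main 1 h1 h⟩
  · refine ⟨-Complex.I, hI, main _ hI ?_⟩
    have : (fun s => (heisZeta (-Complex.I) γ s).re) = fun s => (heisZeta 1 γ s).im := by
      funext s
      simp [heisZeta]
    rw [this]
    exact h

open Classical in
/-- Near a point off the pole, every function `φ` with compact support is, up to a positive factor,
minus the contact Hamiltonian of a variation. In Heisenberg coordinates the variation keeps `x`,
adds `s φ'/(2 x')` to `y`, and adds to `r` what the contact condition then prescribes. -/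
theorem exists_variation (hJ : IsOpen J) (hγ : IsLegendrian J γ) {t₀ : ℝ}
    (ht₀ : t₀ ∈ J) (h0 : homogCurve γ t₀ 0 ≠ 0) :
    ∃ I : Set ℝ, IsOpen I ∧ t₀ ∈ I ∧ I ⊆ J ∧ ∀ φ : ℝ → ℝ, ContDiff ℝ ∞ φ → tsupport φ ⊆ I →
      ∃ g : ℝ → ℝ → C2, ContDiffOn ℝ ∞ (fun x : ℝ × ℝ => g x.1 x.2) (J ×ˢ Set.univ) ∧
        (∀ t ∈ J, g t 0 = γ t) ∧ (∀ s, IsLegendrian J (fun t => g t s)) ∧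
        (∀ t ∈ J, t ∉ tsupport φ → variationField g t = 0) ∧
        ∀ Γ₀ : ℝ → C3, IsNormalizedLift J γ Γ₀ → ∀ t ∈ I,
          ∃ ρ : ℝ, 0 < ρ ∧ hamiltonian Γ₀ g t = -(ρ * φ t) := by
  obtain ⟨c, hc, I, hI, htI, hIJ, x, y, r, hx, hy, hr, hx0, hcon, hγe⟩ :=
    exists_heisenberg_coordinates hJ hγ ht₀ h0
  refine ⟨I, hI, htI, hIJ, fun φ hφ hsupp => ?_⟩
  set k : ℝ → ℝ := fun t => deriv φ t / (2 * deriv x t) with hk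
  set q : ℝ → ℝ := fun t => φ t - x t * k t with hq
  have hφI : ContDiffOn ℝ ∞ φ I := hφ.contDiffOn
  have hks : ContDiffOn ℝ ∞ k I := (contDiffOn_deriv hI hφI).div
    (contDiffOn_const.mul (contDiffOn_deriv hI hx)) fun t ht => mul_ne_zero two_ne_zero (hx0 t ht)
  have hqs : ContDiffOn ℝ ∞ q I := hφI.sub (hx.mul hks)
  set p : ℝ → ℝ → C2 := fun t s => heisPoint c (x t) (y t + s * k t) (r t + s * q t) with hp
  set g : ℝ → ℝ → C2 := fun t s => if t ∈ I then p t s else γ t with hg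
  have hgI : ∀ t ∈ I, ∀ s, g t s = p t s := fun t ht s => if_pos ht
  have hgoff : ∀ t ∈ J, t ∉ tsupport φ → ∀ s, g t s = γ t := fun t ht hts s => by
    by_cases h : t ∈ I
    · have h1 : φ t = 0 := image_eq_zero_of_notMem_tsupport hts
      have h2 : deriv φ t = 0 := image_eq_zero_of_notMem_tsupport
        (fun h => hts (tsupport_deriv_subset (𝕜 := ℝ) h))
      rw [hgI t h s, hγe t h]
      simp [hp, hq, hk, h1, h2]
    · exact if_neg h
  have hMo : IsOpen (J \ tsupport φ) := hJ.sdiff (isClosed_tsupport φ)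
  have hcover : I ∪ (J \ tsupport φ) = J := by
    ext t
    constructor
    · rintro (h | h)
      · exact hIJ h
      · exact h.1
    · intro h
      by_cases hts : t ∈ tsupport φ
      · exact Or.inl (hsupp hts)
      · exact Or.inr ⟨h, hts⟩
  have hfst : ∀ {F : ℝ → ℝ}, ContDiffOn ℝ ∞ F I →
      ContDiffOn ℝ ∞ (fun z : ℝ × ℝ => F z.1) (I ×ˢ Set.univ) := fun hF =>
    hF.comp contDiff_fst.contDiffOn fun z hz => hz.1
  have hsnd : ContDiffOn ℝ ∞ (fun z : ℝ × ℝ => z.2) (I ×ˢ Set.univ) := contDiff_snd.contDiffOn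
  refine ⟨g, ?_, ?_, ?_, ?_, ?_⟩
  · have h1 : ContDiffOn ℝ ∞ (fun z : ℝ × ℝ => g z.1 z.2) (I ×ˢ Set.univ) :=
      (contDiffOn_heisPoint c (hfst hx) ((hfst hy).add (hsnd.mul (hfst hks)))
        ((hfst hr).add (hsnd.mul (hfst hqs)))).congr fun z hz => hgI z.1 hz.1 z.2
    have h2 : ContDiffOn ℝ ∞ (fun z : ℝ × ℝ => g z.1 z.2) ((J \ tsupport φ) ×ˢ Set.univ) :=
      (hγ.smooth.comp (t := J) contDiff_fst.contDiffOn fun z hz => hz.1.1).congr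
        fun z hz => hgoff z.1 hz.1.1 hz.1.2 z.2
    have := h1.union_of_isOpen h2 (hI.prod isOpen_univ) (hMo.prod isOpen_univ)
    rwa [← Set.union_prod, hcover] at this
  · intro t ht
    by_cases h : t ∈ I
    · rw [hgI t h, hγe t h]; simp [hp]
    · exact if_neg h
  · intro s
    rw [← hcover]
    refine IsLegendrian.union hI hMo ?_ ?_
    · refine (isLegendrian_heisPoint hc hI hx (hy.add (contDiffOn_const (c := s) |>.mul hks))
        (hr.add (contDiffOn_const (c := s) |>.mul hqs)) hx0 fun t ht => ?_).congr hI
        fun t ht => hgI t ht s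
      have hd : ∀ {F : ℝ → ℝ}, ContDiffOn ℝ ∞ F I → HasDerivAt F (deriv F t) t := fun hF =>
        ((hF.differentiableOn (by simp)).differentiableAt (hI.mem_nhds ht)).hasDerivAt
      have e1 := ((hd hy).fun_add ((hd hks).const_mul s)).deriv
      have e2 := ((hd hφI).fun_sub ((hd hx).fun_mul (hd hks))).deriv
      have e3 := ((hd hr).fun_add ((hd hqs).const_mul s)).deriv
      have e4 : deriv φ t = 2 * deriv x t * k t := by
        have := hx0 t ht
        simp only [hk]
        field_simp
      have h3 : deriv q t = deriv φ t - (deriv x t * k t + x t * deriv k t) := e2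
      rw [e3, e1, h3, e4]
      linear_combination hcon t ht
    · exact (hγ.mono fun t ht => ht.1).congr hMo fun t ht => hgoff t ht.1 ht.2 s
  · intro t ht hts
    simp only [variationField, hgoff t ht hts, deriv_const]
  · intro Γ₀ hΓ₀ t ht
    have htJ := hIJ ht
    have hgt : (fun s => g t s) = p t := funext fun s => hgI t ht s
    have hy' : HasDerivAt (fun s => y t + s * k t) (k t) 0 := by
      simpa using ((hasDerivAt_id (0 : ℝ)).mul_const (k t)).const_add (y t)
    have hr' : HasDerivAt (fun s => r t + s * q t) (q t) 0 := by
      simpa using ((hasDerivAt_id (0 : ℝ)).mul_const (q t)).const_add (r t)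
    have hW := hasDerivAt_heisVec c (hasDerivAt_const (0 : ℝ) (x t)) hy' hr'
    have hcst : ∀ a b : ℝ, ContDiffOn ℝ ∞ (fun s : ℝ => a + s * b) Set.univ := fun a b =>
      (contDiff_const.add (contDiff_id.mul contDiff_const)).contDiffOn
    have hm := (((contDiffOn_heisFactor (contDiffOn_const (c := x t)) (hcst (y t) (k t))
      (hcst (r t) (q t))).differentiableOn (by simp)).differentiableAt
        (x := (0 : ℝ)) Filter.univ_mem).hasDerivAt
    have hpd := (((contDiffOn_heisPoint c (contDiffOn_const (c := x t)) (hcst (y t) (k t))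
      (hcst (r t) (q t))).differentiableOn (by simp)).differentiableAt
        (x := (0 : ℝ)) Filter.univ_mem).hasDerivAt
    have h1 := hasDerivAt_homog hpd
    have h2 := hm.smul hW
    have h3 : (fun s => homog (heisPoint c (x t) (y t + s * k t) (r t + s * q t))) =
        fun s => heisFactor (x t) (y t + s * k t) (r t + s * q t) •
          heisVec c (x t) (y t + s * k t) (r t + s * q t) := funext fun s => homog_heisPoint _ _ _ _
    rw [h3] at h1
    have h4 := h1.unique h2
    have hV : homogLin (variationField g t) =
        homogLin (deriv (fun s => heisPoint c (x t) (y t + s * k t) (r t + s * q t)) 0) := by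
      rw [variationField, hgt]
    rw [h4] at hV
    obtain ⟨hχ, hΓe⟩ := hΓ₀.eq_smul htJ
    have hZ : homogCurve γ t = heisFactor (x t) (y t) (r t) • heisVec c (x t) (y t) (r t) := by
      rw [homogCurve, hγe t ht, homog_heisPoint]
    set χ := chartForm (Γ₀ t) with hχdef
    set μ := heisFactor (x t) (y t) (r t) with hμ
    have hμ0 : μ ≠ 0 := inv_ne_zero (one_sub_heisEta_ne_zero _ _ _)
    refine ⟨Complex.normSq (χ * μ), Complex.normSq_pos.2 (mul_ne_zero hχ hμ0), ?_⟩
    simp only [zero_mul, add_zero] at hV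
    rw [hamiltonian, ← hχdef, hΓe, hZ, hV]
    simp only [herm_add_right, herm_smul_right, herm_smul_left, herm_heisVec hc, herm_heisVel hc,
      mul_zero, add_zero, sub_zero]
    have hqk : q t + x t * k t = φ t := by simp [hq]
    rw [hqk, ← hμ]
    have : χ * (μ * (starRingEnd ℂ χ * (starRingEnd ℂ μ * (Complex.I * (φ t : ℂ))))) =
        (Complex.normSq (χ * μ) * φ t : ℝ) * Complex.I := by
      push_cast
      rw [← Complex.mul_conj, map_mul]
      ring
    rw [this]
    simp

end Coordinates

/-! ### Critical curves -/

section Critical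

variable {J : Set ℝ} {γ : ℝ → C2}

theorem IsNormalizedLift.congr {σ : ℝ → C2} {Γ : ℝ → C3} (h : IsNormalizedLift J γ Γ)
    (he : Set.EqOn σ γ J) : IsNormalizedLift J σ Γ :=
  ⟨h.smooth, fun t ht => he ht ▸ h.lift t ht, h.normalized⟩

/-- The stress vanishes exactly when `D u = 0` wherever `a ≠ 0`; for the converse, `a` vanishes
identically or nowhere, so there is no isolated zero at which the stress could survive. -/
theorem stressVanishes_iff {a b : ℝ → ℝ} (hJ : IsOpen J) (hJc : J.OrdConnected)
    (ha : ContDiffOn ℝ ∞ a J) (hb : ContDiffOn ℝ ∞ b J) :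
    (∀ t ∈ J, stressPolynomial a b t = 0) ↔
      ∀ t ∈ J, a t ≠ 0 → fifthOrder b (multiplier a) t = 0 := by
  have hNo : IsOpen {t | t ∈ J ∧ a t ≠ 0} := ha.continuousOn.isOpen_inter_preimage hJ isOpen_ne
  have key : ∀ t ∈ J, a t ≠ 0 →
      a t ^ 5 * fifthOrder b (multiplier a) t = 2 * multiplier a t * stressPolynomial a b t :=
    fun t ht h0 => fifthOrder_multiplier hNo (ha.mono fun t ht => ht.1) (fun t ht => ht.2) ⟨ht, h0⟩
  constructor
  · intro h t ht h0
    have := key t ht h0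
    rw [h t ht, mul_zero] at this
    exact (mul_eq_zero.1 this).resolve_left (pow_ne_zero 5 h0)
  · intro h t ht
    rcases eq_zero_or_ne_zero_of_fifthOrder hJ hJc ha hb h with h0 | h0
    · have hk : ∀ k, iteratedDeriv k a t = 0 := fun k => by
        rw [iteratedDeriv_eqOn hJ (fun s hs => h0 s hs : Set.EqOn a (fun _ => 0) J) k ht]
        simp
      simp only [stressPolynomial, hk, h0 t ht]
      ring
    · have := key t ht (h0 t ht)
      rw [h t ht (h0 t ht), mul_zero] at this
      exact (mul_eq_zero.1 this.symm).resolve_left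
        (mul_ne_zero two_ne_zero (multiplier_ne_zero (h0 t ht)))

/-- A compact subset of an open interval lies in the interior of a compact subinterval. -/
theorem exists_Icc_of_isCompact (hJ : IsOpen J) (hJc : J.OrdConnected) (hJn : J.Nonempty)
    {K : Set ℝ} (hK : IsCompact K) (hKJ : K ⊆ J) :
    ∃ α β, α ≤ β ∧ Set.Icc α β ⊆ J ∧ K ⊆ Set.Ioo α β := by
  obtain ⟨t₀, ht₀⟩ := hJn
  have hL : IsCompact (insert t₀ K) := hK.insert t₀
  have hLJ : insert t₀ K ⊆ J := Set.insert_subset ht₀ hKJ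
  have hne : (insert t₀ K).Nonempty := ⟨t₀, Set.mem_insert _ _⟩
  obtain ⟨p, hp, hpm⟩ := hL.exists_isLeast hne
  obtain ⟨q, hq, hqm⟩ := hL.exists_isGreatest hne
  obtain ⟨δ, hδ, hδJ⟩ := Metric.isOpen_iff.1 hJ p (hLJ hp)
  obtain ⟨δ', hδ', hδJ'⟩ := Metric.isOpen_iff.1 hJ q (hLJ hq)
  have hpq : p ≤ q := hpm hq
  have hα : p - δ / 2 ∈ J := hδJ (by
    rw [Metric.mem_ball, Real.dist_eq, abs_lt]; constructor <;> linarith)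
  have hβ : q + δ' / 2 ∈ J := hδJ' (by
    rw [Metric.mem_ball, Real.dist_eq, abs_lt]; constructor <;> linarith)
  refine ⟨p - δ / 2, q + δ' / 2, by linarith, hJc.out hα hβ, fun t ht => ?_⟩
  have h1 := hpm (Set.mem_insert_of_mem _ ht)
  have h2 := hqm (Set.mem_insert_of_mem _ ht)
  constructor <;> linarith

theorem variationSupport_subset_of_isClosed {g : ℝ → ℝ → C2} {T : Set ℝ} (hT : IsClosed T)
    (h : ∀ t ∈ J, t ∉ T → variationField g t = 0) : variationSupport J g ⊆ T := fun t ht =>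
  hT.closure_subset_iff.2 (fun s hs => by
    by_contra hsT
    exact hs.2 (h s hs.1 hsT)) ht.2

/-- The support of a variation field which vanishes off a compact subset of `J` is compact. -/
theorem isCompact_variationSupport {g : ℝ → ℝ → C2} {T : Set ℝ} (hT : IsCompact T) (hTJ : T ⊆ J)
    (h : ∀ t ∈ J, t ∉ T → variationField g t = 0) : IsCompact (variationSupport J g) := by
  have hsub : closure {t | t ∈ J ∧ variationField g t ≠ 0} ⊆ T :=
    hT.isClosed.closure_subset_iff.2 fun s hs => by
      by_contra hsT
      exact hs.2 (h s hs.1 hsT)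
  rw [variationSupport, Set.inter_eq_right.2 (hsub.trans hTJ)]
  exact hT.of_isClosed_subset isClosed_closure hsub

/-- A Legendrian curve is not at the pole `(-1, 0)` on an open set of parameters. -/
theorem exists_off_pole (hγ : IsLegendrian J γ) {N : Set ℝ} (hN : IsOpen N)
    (hNJ : N ⊆ J) (hne : N.Nonempty) : ∃ t ∈ N, homogCurve γ t 0 ≠ 0 := by
  by_contra hcon
  push Not at hcon
  have hconst : Set.EqOn (homogCurve γ) (fun _ => ![0, 0, Complex.I]) N := fun t ht => by
    have h0 := hcon t ht
    have h1 := hγ.herm_self (hNJ ht)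
    rw [herm, h0] at h1
    simp at h1
    have h2 : chartForm (homogCurve γ t) = 1 := chartForm_homog (γ t)
    rw [chartForm, h0] at h2
    ext i
    fin_cases i
    · exact h0
    · exact h1
    · change homogCurve γ t 2 = Complex.I
      linear_combination Complex.I * h2 + homogCurve γ t 2 * Complex.I_sq
  obtain ⟨t, ht⟩ := hne
  refine (hγ.mono hNJ).herm_deriv_deriv_ne hN ht ?_
  rw [iteratedDeriv_eqOn hN hconst 1 ht]
  simp [herm]

theorem isCritical_of_fifthOrder (hJ : IsOpen J) (hJc : J.OrdConnected) (hJn : J.Nonempty)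
    (hγ : IsLegendrian J γ)
    (hD : ∀ t ∈ J, cubicDensity J γ t ≠ 0 →
      fifthOrder (quadraticDensity J γ) (multiplier (cubicDensity J γ)) t = 0) :
    IsCritical J γ := by
  intro ε hε g hg
  set Γ₀ := normalizedLift J γ with hΓ₀def
  have hΓ₀ : IsNormalizedLift J γ Γ₀ := normalizedLift_spec hγ hJ hJc hJn
  have hg0 : Set.EqOn (fun t => g t 0) γ J := fun t ht => hg.initial t ht
  have hΓg : IsNormalizedLift J (fun t => g t 0) Γ₀ := hΓ₀.congr hg0
  rcases eq_zero_or_ne_zero_of_fifthOrder hJ hJc (hΓ₀.contDiffOn_cubicOf hJ)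
    (hΓ₀.contDiffOn_quadraticOf hJ) hD with h0 | h0
  · -- The total strain is nonnegative and vanishes along a cycle.
    have hz : strainFunctional J g 0 = 0 := by
      rw [strainFunctional]
      refine MeasureTheory.setIntegral_eq_zero_of_forall_eq_zero fun t ht => ?_
      have h1 := cubicDensity_eq hJ hJc (hg.legendrian 0 ⟨by linarith, hε⟩) hJ subset_rfl hΓg ht.1
      rw [strainDensity, h1, h0 t ht.1]
      norm_num
    have hmin : IsLocalMin (strainFunctional J g) 0 := Filter.Eventually.of_forall fun s => by
      rw [hz]
      exact MeasureTheory.integral_nonneg fun t => Real.rpow_nonneg (abs_nonneg _) _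
    exact hmin.deriv_eq_zero
  · obtain ⟨U, G, hG⟩ := exists_isJointLift hJ hε hg.smooth hg.legendrian hΓg
    obtain ⟨α, β, hαβ, hJαβ, hK⟩ := exists_Icc_of_isCompact hJ hJc hJn hg.compact_support
      Set.inter_subset_left
    rw [(hG.hasDerivAt_strainFunctional hJ hJc hε hg.legendrian hg.compact_support hαβ hJαβ hK
      fun t ht => h0 t (hJαβ ht)).deriv]
    have : ∫ t in α..β, hamiltonian Γ₀ g t *
        fifthOrder (quadraticOf Γ₀) (multiplier (cubicOf Γ₀)) t = ∫ t in α..β, (0 : ℝ) := by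
      refine intervalIntegral.integral_congr fun t ht => ?_
      rw [Set.uIcc_of_le hαβ] at ht
      change _ * fifthOrder (quadraticDensity J γ) (multiplier (cubicDensity J γ)) t = 0
      rw [hD t (hJαβ ht) (h0 t (hJαβ ht)), mul_zero]
    rw [this]
    simp

/-- A critical curve satisfies `D u = 0` wherever `a ≠ 0`: otherwise a bump near such a point, as
contact Hamiltonian, gives a variation along which the total strain has nonzero derivative. -/
theorem fifthOrder_of_isCritical (hJ : IsOpen J) (hJc : J.OrdConnected)
    (hγ : IsLegendrian J γ) (hcrit : IsCritical J γ) {t₀ : ℝ} (ht₀ : t₀ ∈ J)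
    (ha₀ : cubicDensity J γ t₀ ≠ 0) :
    fifthOrder (quadraticDensity J γ) (multiplier (cubicDensity J γ)) t₀ = 0 := by
  set Γ₀ := normalizedLift J γ with hΓ₀def
  have hΓ₀ : IsNormalizedLift J γ Γ₀ := normalizedLift_spec hγ hJ hJc ⟨t₀, ht₀⟩
  change fifthOrder (quadraticOf Γ₀) (multiplier (cubicOf Γ₀)) t₀ = 0
  change cubicOf Γ₀ t₀ ≠ 0 at ha₀
  have has := hΓ₀.contDiffOn_cubicOf hJ
  have hbs := hΓ₀.contDiffOn_quadraticOf hJ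
  set N : Set ℝ := {t | t ∈ J ∧ cubicOf Γ₀ t ≠ 0} with hN
  have hNo : IsOpen N := has.continuousOn.isOpen_inter_preimage hJ isOpen_ne
  set D : ℝ → ℝ := fifthOrder (quadraticOf Γ₀) (multiplier (cubicOf Γ₀)) with hDdef
  have hDs : ContDiffOn ℝ ∞ D N := contDiffOn_fifthOrder hNo (hbs.mono fun t ht => ht.1)
    (contDiffOn_multiplier (has.mono fun t ht => ht.1) fun t ht => ht.2)
  by_contra hD0
  -- Move `t₀` off the pole of the Heisenberg chart, keeping `D u ≠ 0`.
  obtain ⟨t₁, ⟨ht₁N, ht₁D⟩, ht₁⟩ := exists_off_pole hγ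
    (hDs.continuousOn.isOpen_inter_preimage hNo (isOpen_ne (x := (0 : ℝ))))
    (fun t ht => ht.1.1) ⟨t₀, ⟨ht₀, ha₀⟩, hD0⟩
  obtain ⟨I, hI, ht₁I, hIJ, hvar⟩ := exists_variation hJ hγ ht₁N.1 ht₁
  set σ := D t₁ with hσ
  have hSo : IsOpen ((N ∩ (fun t => σ * D t) ⁻¹' Set.Ioi 0) ∩ I) :=
    ((continuousOn_const.mul hDs.continuousOn).isOpen_inter_preimage hNo isOpen_Ioi).inter hI
  have ht₁S : t₁ ∈ (N ∩ (fun t => σ * D t) ⁻¹' Set.Ioi 0) ∩ I :=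
    ⟨⟨ht₁N, mul_self_pos.2 ht₁D⟩, ht₁I⟩
  obtain ⟨δ, hδ, hδS⟩ := Metric.nhds_basis_closedBall.mem_iff.1 (hSo.mem_nhds ht₁S)
  rw [Real.closedBall_eq_Icc] at hδS
  let ψ : ContDiffBump t₁ := ⟨δ / 4, δ / 2, by linarith, by linarith⟩
  set φ : ℝ → ℝ := fun t => σ * ψ t with hφ
  have hφs : ContDiff ℝ ∞ φ := contDiff_const.mul ψ.contDiff
  have hsupp : tsupport φ ⊆ Set.Icc (t₁ - δ / 2) (t₁ + δ / 2) := by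
    have : tsupport φ ⊆ tsupport ψ := tsupport_mul_subset_right
    rwa [ψ.tsupport_eq, Real.closedBall_eq_Icc] at this
  have hsuppδ : tsupport φ ⊆ Set.Ioo (t₁ - δ) (t₁ + δ) := fun t ht => by
    have := hsupp ht
    constructor <;> linarith [this.1, this.2]
  have hφc : IsCompact (tsupport φ) :=
    isCompact_Icc.of_isClosed_subset (isClosed_tsupport φ) hsupp
  obtain ⟨g, hgs, hg0, hgl, hgv, hgh⟩ := hvar φ hφs fun t ht =>
    (hδS (Set.Ioo_subset_Icc_self (hsuppδ ht))).2
  have hK : IsCompact (variationSupport J g) := isCompact_variationSupport hφc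
    (fun t ht => (hδS (Set.Ioo_subset_Icc_self (hsuppδ ht))).1.1.1) hgv
  have hgs' : ContDiffOn ℝ ∞ (fun x : ℝ × ℝ => g x.1 x.2) (J ×ˢ Set.Ioo (-1 : ℝ) 1) :=
    hgs.mono (Set.prod_mono_right (Set.subset_univ _))
  have hΓg : IsNormalizedLift J (fun t => g t 0) Γ₀ := hΓ₀.congr fun t ht => hg0 t ht
  obtain ⟨U, G, hG⟩ := exists_isJointLift hJ one_pos hgs' (fun s _ => hgl s) hΓg
  have hder := hG.hasDerivAt_strainFunctional hJ hJc one_pos (fun s _ => hgl s) hK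
    (show t₁ - δ ≤ t₁ + δ by linarith) (fun t ht => (hδS ht).1.1.1)
    ((variationSupport_subset_of_isClosed (isClosed_tsupport φ) hgv).trans hsuppδ)
    (fun t ht => (hδS ht).1.1.2)
  have hzero := hcrit 1 one_pos g ⟨hgs', hg0, fun s _ => hgl s, hK, hder.differentiableAt⟩
  rw [hder.deriv] at hzero
  have hpos : 0 < ∫ t in (t₁ - δ)..(t₁ + δ), -(hamiltonian Γ₀ g t * D t) := by
    have hval : ∀ t ∈ Set.Icc (t₁ - δ) (t₁ + δ), ∃ ρ : ℝ, 0 < ρ ∧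
        -(hamiltonian Γ₀ g t * D t) = ρ * ψ t * (σ * D t) := fun t ht => by
      obtain ⟨ρ, hρ, h⟩ := hgh Γ₀ hΓ₀ t (hδS ht).2
      exact ⟨ρ, hρ, by rw [h, hφ]; ring⟩
    refine intervalIntegral.integral_pos (by linarith) ?_ ?_ ?_
    · exact ((hG.contDiffOn_hamiltonian.continuousOn.mono fun t ht => (hδS ht).1.1.1).mul
        (hDs.continuousOn.mono fun t ht => (hδS ht).1.1)).neg
    · intro t ht
      have ht' := Set.Ioc_subset_Icc_self ht
      obtain ⟨ρ, hρ, h⟩ := hval t ht'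
      rw [h]
      exact mul_nonneg (mul_nonneg hρ.le ψ.nonneg) (le_of_lt (hδS ht').1.2)
    · have ht' : t₁ ∈ Set.Icc (t₁ - δ) (t₁ + δ) := ⟨by linarith, by linarith⟩
      refine ⟨t₁, ht', ?_⟩
      obtain ⟨ρ, hρ, h⟩ := hval t₁ ht'
      rw [h, ψ.one_of_mem_closedBall (Metric.mem_closedBall_self ψ.rIn_pos.le), mul_one]
      exact mul_pos hρ (hδS ht').1.2
  rw [intervalIntegral.integral_neg] at hpos
  linarith

end Critical

end CRStrain

theorem theoremA (J : Set ℝ) (hJo : IsOpen J) (hJc : J.OrdConnected) (hJn : J.Nonempty)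
    (γ : ℝ → CRStrain.C2) (hγ : CRStrain.IsLegendrian J γ) :
    (CRStrain.IsCritical J γ ↔ CRStrain.StressVanishes J γ) ∧
      (CRStrain.IsCritical J γ →
        Xor (CRStrain.IsCycle J γ) (CRStrain.IsGeneric J γ)) := by
  have hΓ₀ := CRStrain.normalizedLift_spec hγ hJo hJc hJn
  have has : ContDiffOn ℝ ∞ (CRStrain.cubicDensity J γ) J := hΓ₀.contDiffOn_cubicOf hJo
  have hbs : ContDiffOn ℝ ∞ (CRStrain.quadraticDensity J γ) J := hΓ₀.contDiffOn_quadraticOf hJo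
  have hstress := CRStrain.stressVanishes_iff hJo hJc has hbs
  have hfwd : CRStrain.IsCritical J γ → ∀ t ∈ J, CRStrain.cubicDensity J γ t ≠ 0 →
      CRStrain.fifthOrder (CRStrain.quadraticDensity J γ)
        (CRStrain.multiplier (CRStrain.cubicDensity J γ)) t = 0 :=
    fun h t ht ha => CRStrain.fifthOrder_of_isCritical hJo hJc hγ h ht ha
  refine ⟨⟨fun h => hstress.2 (hfwd h),
    fun h => CRStrain.isCritical_of_fifthOrder hJo hJc hJn hγ (hstress.1 h)⟩, fun h => ?_⟩
  obtain ⟨t, ht⟩ := hJn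
  rcases CRStrain.eq_zero_or_ne_zero_of_fifthOrder hJo hJc has hbs (hfwd h) with h0 | h0
  · exact Or.inl ⟨h0, fun hgen => hgen t ht (h0 t ht)⟩
  · exact Or.inr ⟨h0, fun hcyc => h0 t ht (hcyc t ht)⟩
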